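/- For positive integers $n,m$ let $T_{n,m}=\mathbb Z/n\mathbb Z\times\mathbb Z/m\mathbb Z$ be the discrete torus, regarded as a directed graph in which every vertex $(x,y)$ has two outgoing edges, to $(x+1,y)$ and to $(x,y+1)$. A cycle-rooted spanning forest (CRSF) of $T_{n,m}$ is a subgraph in which every vertex has exactly one outgoing edge. Let $\mathbb P$ denote the uniform probability measure on the CRSFs of $T_{n,m}$; equivalently, each vertex independently chooses one of its two outgoing edges with probability $1/2$ each. The cycles of a CRSF are its directed closed cycles, i.e. the periodic orbits of the map that sends every vertex to the endpoint of its outgoing edge. **Proposition.** Let $p,q\ge 1$ be coprime integers, let $C\in\mathbb R$ satisfy $|C|>\sqrt{2p}$, and let $m=m(n)$ be a sequence of natural numbers such that $$m=\frac pq\,n+C\sqrt{n\log n}\,\bigl(1+o(1)\bigr)\qquad (n\to\infty).$$ Then for every $\epsilon>0$ there exists $n_0$ such that, for every $n\ge n_0$, the uniformly random CRSF of $T_{n,m}$ satisfies $$\mathbb P\bigl(\text{there exist at least two disjoint cycles}\bigr)\le n^{\frac12-\frac{C^2}{4p}+\epsilon}.$$ -/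

import Mathlib

open Filter Topology MeasureTheory

namespace TorusCRSF

/-- The torus `T_{n,m} = ℤ/nℤ × ℤ/mℤ` (for positive `n` and `m`). -/
abbrev Torus (n m : ℕ) : Type := ZMod n × ZMod m

/-- The two outgoing edges of a vertex of the directed torus. -/
inductive Step : Type
  | east
  | north
  deriving DecidableEq

instance instFintypeStep : Fintype Step where
  elems := {Step.east, Step.north}
  complete := by intro s; cases s <;> simp

instance instMeasurableSpaceStep : MeasurableSpace Step := ⊤

instance instDiscreteMeasurableSpaceStep : DiscreteMeasurableSpace Step := ⟨fun _ => trivial⟩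

/-- The endpoint of the edge that leaves `v` in the given direction: `(x+1, y)` or `(x, y+1)`. -/
def Step.target {n m : ℕ} : Step → Torus n m → Torus n m
  | Step.east, v => (v.1 + 1, v.2)
  | Step.north, v => (v.1, v.2 + 1)

/-- A cycle-rooted spanning forest of the directed torus: a subgraph in which every vertex has
exactly one outgoing edge, recorded as the choice of that edge at every vertex. -/
abbrev CRSF (n m : ℕ) : Type := Torus n m → Step

/-- The uniform probability measure on the cycle-rooted spanning forests of the torus. -/
noncomputable def crsfMeasure (n m : ℕ) : Measure (CRSF n m) :=
  ProbabilityTheory.uniformOn Set.univ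

/-- The map `φ` that sends each vertex to the vertex at the end of its outgoing edge. -/
def CRSF.next {n m : ℕ} (ω : CRSF n m) (v : Torus n m) : Torus n m :=
  (ω v).target v

/-- `S` is the vertex set of a (directed, closed) cycle of the forest `ω`. -/
def CRSF.IsCycle {n m : ℕ} (ω : CRSF n m) (S : Set (Torus n m)) : Prop :=
  ∃ v ∈ Function.periodicPts (CRSF.next ω), S = Set.range (fun k : ℕ => (CRSF.next ω)^[k] v)

/-- The event that there exist at least two disjoint cycles. -/
def twoDisjointCycles (n m : ℕ) : Set (CRSF n m) :=
  {ω | ∃ S₁ S₂ : Set (Torus n m), CRSF.IsCycle ω S₁ ∧ CRSF.IsCycle ω S₂ ∧ Disjoint S₁ S₂}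

end TorusCRSF

namespace TorusCRSF

/-! Fix a length scale `T` and split according to whether some cycle has fewer than `T` vertices.

Short cycles: a closed walk winding `a` times horizontally and `b` times vertically has `a * n` east
and `b * m` north steps. Each such self-avoiding walk from a given vertex has probability `2 ^ (-(a
* n + b * m))`, so a binomial probability bounds their total. Every cycle meets an axis, so only `n
+ m` starting points are needed. If `(a, b) = j (p, q)`, the imbalance of the walk is `j * D` with
`D = p n - q m ≈ -q C √(n log n)`, while its length is about `2 j p n`. The local Gaussian bound
gives `n^(-1/2)` times the `j`-th power of roughly `n^(-q² C² / (4p))`. Summing over `j` and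
multiplying by `n + m` yields the exponent `1/2 - C² / (4p)`, since `q ≥ 1`. For every other class
the imbalance is at least of order `n`, so the contribution is exponentially small
(`closed_walk_nonresonant_le`).

Long cycles: take vertices of two disjoint cycles that are adjacent on an antidiagonal and follow
both. The strands remain adjacent (`gap_next`), and their gap is a lazy random walk that stays
positive. The antidiagonal segments between them are disjoint, so the gaps over `T` steps sum to at
most `n m` (`sum_gap_le`). A positive walk of length `T` with area at most `A` has probability at
most `2 exp(-T³ / (96 A²))` (`card_narrowPairs_le`), which is negligible when `T³` dominates `n⁴` by
a power of `n`.

The choice `T ≈ n^(7/5)` makes the second part negligible and keeps the non-resonant classes away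
from resonance. -/

/-- The horizontal displacement of a step. -/
def Step.dx : Step → ℕ
  | Step.east => 1
  | Step.north => 0

/-- The vertical displacement of a step. -/
def Step.dy : Step → ℕ
  | Step.east => 0
  | Step.north => 1

lemma Step.dx_add_dy (s : Step) : s.dx + s.dy = 1 := by cases s <;> rfl

lemma Step.card : Fintype.card Step = 2 := rfl

lemma Step.target_eq {n m : ℕ} (s : Step) (v : Torus n m) :
    s.target v = (v.1 + (s.dx : ZMod n), v.2 + (s.dy : ZMod m)) := by
  cases s <;> simp [Step.target, Step.dx, Step.dy]

/-! ### Cylinder events and union bounds. -/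

instance isProbabilityMeasure_crsfMeasure (n m : ℕ) [NeZero n] [NeZero m] :
    IsProbabilityMeasure (crsfMeasure n m) :=
  ProbabilityTheory.isProbabilityMeasure_uniformOn Set.finite_univ
    ⟨fun _ => Step.east, Set.mem_univ _⟩

/-- The probability of a cylinder event. -/
lemma crsfMeasure_cylinder {n m : ℕ} [NeZero n] [NeZero m] {ι : Type*} [Fintype ι]
    (u : ι → Torus n m) (hu : Function.Injective u) (s : ι → Step) :
    (crsfMeasure n m).real {ω | ∀ i, ω (u i) = s i} = ((1 : ℝ) / 2) ^ Fintype.card ι := by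
  classical
  have hset : {ω : CRSF n m | ∀ i, ω (u i) = s i} =
      ((Fintype.piFinset fun v : Torus n m =>
        if h : ∃ i, u i = v then {s h.choose} else (Finset.univ : Finset Step) :
          Finset (CRSF n m)) : Set (CRSF n m)) := by
    ext ω
    simp only [Set.mem_ofPred_eq, Finset.mem_coe, Fintype.mem_piFinset]
    constructor
    · intro h v
      split_ifs with hv
      · rw [Finset.mem_singleton, ← h, hv.choose_spec]
      · exact Finset.mem_univ _
    · intro h i
      have h1 := h (u i)
      have hex : ∃ j, u j = u i := ⟨i, rfl⟩
      rw [dif_pos hex, Finset.mem_singleton, hu hex.choose_spec] at h1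
      exact h1
  have hcard : (Fintype.piFinset fun v : Torus n m =>
        if h : ∃ i, u i = v then {s h.choose} else (Finset.univ : Finset Step)).card *
          2 ^ Fintype.card ι = 2 ^ Fintype.card (Torus n m) := by
    rw [Fintype.card_piFinset]
    have h1 : ∀ v : Torus n m, (if h : ∃ i, u i = v then {s h.choose} else
        (Finset.univ : Finset Step)).card = if v ∈ Finset.univ.image u then 1 else 2 := by
      intro v
      by_cases h : ∃ i, u i = v
      · simp [h]
      · have : ¬ ∃ i, u i = v := h
        rw [dif_neg h, if_neg (by simpa using h)]; rfl
    simp only [h1]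
    rw [Finset.prod_ite, Finset.prod_const_one, one_mul, Finset.prod_const, ← pow_add]
    congr 1
    have h2 : Fintype.card ι = (Finset.univ.filter (· ∈ Finset.univ.image u)).card := by
      rw [Finset.filter_mem_eq_inter, Finset.univ_inter, Finset.card_image_of_injective _ hu,
        Finset.card_univ]
    rw [h2, add_comm, Finset.card_filter_add_card_filter_not, Finset.card_univ]
  rw [hset, crsfMeasure, Measure.real, ProbabilityTheory.uniformOn_univ,
    Measure.count_apply_finset, Fintype.card_fun, Step.card]
  have h3 : ((Fintype.piFinset fun v : Torus n m =>
        if h : ∃ i, u i = v then {s h.choose} else (Finset.univ : Finset Step)).card : ℝ) *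
          2 ^ Fintype.card ι = 2 ^ Fintype.card (Torus n m) := by exact_mod_cast hcard
  rw [ENNReal.toReal_div]
  simp only [ENNReal.toReal_natCast, Nat.cast_pow, Nat.cast_ofNat, ENNReal.toReal_pow,
    ENNReal.toReal_ofNat]
  rw [← h3]
  have : (Fintype.piFinset fun v : Torus n m =>
        if h : ∃ i, u i = v then {s h.choose} else (Finset.univ : Finset Step)).card ≠ 0 := by
    intro h0
    rw [h0] at h3
    simp at h3
    exact absurd h3.symm (by positivity)
  field_simp
  rw [← mul_pow]
  norm_num

/-- A union bound over cylinder events indexed by a finite set of codes. -/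
lemma crsfMeasure_le_card_codes {n m : ℕ} [NeZero n] [NeZero m] {ι κ : Type*} [Fintype ι]
    (G : Finset κ) (u : κ → ι → Torus n m) (s : κ → ι → Step) (E : Set (CRSF n m))
    (hE : ∀ ω ∈ E, ∃ c ∈ G, Function.Injective (u c) ∧ ∀ i, ω (u c i) = s c i) :
    (crsfMeasure n m).real E ≤ G.card * ((1 : ℝ) / 2) ^ Fintype.card ι := by
  classical
  have hsub : E ⊆ ⋃ c ∈ G.filter (fun c => Function.Injective (u c)),
      {ω | ∀ i, ω (u c i) = s c i} := by
    intro ω hω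
    obtain ⟨c, hc, hu, h⟩ := hE ω hω
    simp only [Set.mem_iUnion]
    exact ⟨c, Finset.mem_filter.2 ⟨hc, hu⟩, h⟩
  calc (crsfMeasure n m).real E ≤ _ := measureReal_mono hsub (measure_ne_top _ _)
    _ ≤ ∑ c ∈ G.filter (fun c => Function.Injective (u c)),
          (crsfMeasure n m).real {ω | ∀ i, ω (u c i) = s c i} :=
        measureReal_biUnion_finset_le _ _
    _ = ∑ c ∈ G.filter (fun c => Function.Injective (u c)), ((1 : ℝ) / 2) ^ Fintype.card ι :=
        Finset.sum_congr rfl fun c hc =>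
          crsfMeasure_cylinder (u c) (Finset.mem_filter.1 hc).2 (s c)
    _ = (G.filter (fun c => Function.Injective (u c))).card * ((1 : ℝ) / 2) ^ Fintype.card ι := by
        rw [Finset.sum_const, nsmul_eq_mul]
    _ ≤ _ := by
        gcongr
        exact Finset.filter_subset _ _

/-! ### Antidiagonals and the gap between neighbouring strands. -/

variable {n m : ℕ}

/-- The vertex reached from `v` by `d` moves along the antidiagonal. -/
def slide (v : Torus n m) (d : ℤ) : Torus n m := (v.1 + (d : ZMod n), v.2 - (d : ZMod m))

/-- The northern neighbour of a vertex. -/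
def up (v : Torus n m) : Torus n m := (v.1, v.2 + 1)

lemma slide_zero (v : Torus n m) : slide v 0 = v := by simp [slide]

lemma slide_slide (v : Torus n m) (a b : ℤ) : slide (slide v a) b = slide v (a + b) := by
  ext <;> simp [slide] <;> ring

lemma slide_mul (v : Torus n m) (k : ℤ) : slide v (n * m * k) = v := by
  ext <;> simp [slide]

lemma up_slide (v : Torus n m) (a : ℤ) : up (slide v a) = slide (up v) a := by
  ext <;> simp [slide, up]; ring

lemma up_injective : Function.Injective (up : Torus n m → Torus n m) := by
  intro v w h
  simp only [up, Prod.mk.injEq, add_left_inj] at h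
  exact Prod.ext h.1 h.2

/-- An east step is a north step followed by a unit slide. A whole antidiagonal thus moves to the
next one at each step, and the slide distance records the relative motion of two walks. -/
lemma next_eq_slide (ω : CRSF n m) (v : Torus n m) : ω.next v = slide (up v) (ω v).dx := by
  unfold CRSF.next
  cases h : ω v <;> ext <;> simp [Step.target, slide, up, Step.dx]

lemma next_slide (ω : CRSF n m) (v : Torus n m) (d : ℤ) :
    ω.next (slide v d) = slide (ω.next v) (d + (ω (slide v d)).dx - (ω v).dx) := by
  rw [next_eq_slide, next_eq_slide, up_slide, slide_slide, slide_slide]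
  congr 1; ring

lemma iterate_next (ω : CRSF n m) (v : Torus n m) (t : ℕ) :
    ω.next^[t] v =
      (v.1 + ((∑ i ∈ Finset.range t, (ω (ω.next^[i] v)).dx : ℕ) : ZMod n),
        v.2 + ((∑ i ∈ Finset.range t, (ω (ω.next^[i] v)).dy : ℕ) : ZMod m)) := by
  induction t with
  | zero => simp
  | succ t ih =>
    rw [Function.iterate_succ_apply', Finset.sum_range_succ, Finset.sum_range_succ]
    rw [CRSF.next, Step.target_eq]
    nth_rewrite 1 [ih]
    nth_rewrite 2 [ih]
    push_cast
    simp only [add_assoc]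

/-- The distance along the antidiagonal from `v` to the next vertex of `S`. -/
noncomputable def gap (S : Set (Torus n m)) (v : Torus n m) : ℕ :=
  sInf {d : ℕ | 1 ≤ d ∧ slide v d ∈ S}

lemma gap_eq {S : Set (Torus n m)} {v : Torus n m} {d : ℕ} (hd : 1 ≤ d) (hS : slide v d ∈ S)
    (hmin : ∀ h : ℕ, 1 ≤ h → h < d → slide v h ∉ S) : gap S v = d := by
  refine le_antisymm (Nat.sInf_le ⟨hd, hS⟩) ?_
  by_contra! hlt
  have h1 : 1 ≤ gap S v ∧ slide v (gap S v) ∈ S :=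
    Nat.sInf_mem (s := {d : ℕ | 1 ≤ d ∧ slide v d ∈ S}) ⟨d, hd, hS⟩
  exact hmin _ h1.1 hlt h1.2

/-- Sliding by `n * m` returns to the start, so the infimum is over a nonempty set and is not the
default value `0`; a vertex alone on its antidiagonal sees itself. -/
lemma gap_spec [NeZero n] [NeZero m] {S : Set (Torus n m)} {v : Torus n m} (hv : v ∈ S) :
    1 ≤ gap S v ∧ slide v (gap S v) ∈ S := by
  refine Nat.sInf_mem (s := {d : ℕ | 1 ≤ d ∧ slide v d ∈ S}) ⟨n * m, ?_, ?_⟩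
  · exact Nat.mul_pos (NeZero.pos n) (NeZero.pos m)
  · have : slide v ((n * m : ℕ) : ℤ) = v := by simpa using slide_mul v 1
    rwa [this]

lemma slide_notMem_of_lt_gap {S : Set (Torus n m)} {v : Torus n m} {h : ℕ} (h1 : 1 ≤ h)
    (h2 : h < gap S v) : slide v h ∉ S := fun h3 =>
  absurd (Nat.sInf_le (s := {d : ℕ | 1 ≤ d ∧ slide v d ∈ S}) ⟨h1, h3⟩) (not_le.2 h2)

lemma Step.dx_le_one (s : Step) : s.dx ≤ 1 := by cases s <;> simp [Step.dx]

/-- Adjacent strands stay adjacent. -/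
lemma gap_next [NeZero n] [NeZero m] {ω : CRSF n m} {S : Set (Torus n m)}
    (hS : Set.BijOn ω.next S S) {v : Torus n m} (hv : v ∈ S) :
    (gap S (ω.next v) : ℤ) = gap S v + (ω (slide v (gap S v))).dx - (ω v).dx := by
  obtain ⟨hg1, hgS⟩ := gap_spec hv
  set g := gap S v with hg
  have he := (ω v).dx_le_one
  have he' := (ω (slide v g)).dx_le_one
  have hns := next_slide ω v g
  -- The new distance is nonnegative; if it were zero the two strands would merge, contrary to
  -- injectivity on `S`.
  have hpos : 1 ≤ (g : ℤ) + (ω (slide v g)).dx - (ω v).dx := by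
    by_contra! hlt
    have h0 : (g : ℤ) + (ω (slide v g)).dx - (ω v).dx = 0 := by omega
    rw [h0, slide_zero] at hns
    have := hS.injOn hgS hv hns
    rw [this] at h0
    omega
  obtain ⟨G, hG⟩ := Int.eq_ofNat_of_zero_le (by omega : 0 ≤ (g : ℤ) + (ω (slide v g)).dx - (ω v).dx)
  rw [hG] at hns hpos ⊢
  refine congrArg Nat.cast (gap_eq (by omega) (hns ▸ hS.mapsTo hgS) fun h h1 hlt hmem => ?_)
  -- A vertex strictly between the two images has a predecessor `u` in `S`, at distance `k` from
  -- `v`. Steps change distances by at most one, so `u` is one of the two strands or lies strictly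
  -- between them; each case is impossible.
  obtain ⟨u, hu, hueq⟩ := hS.surjOn hmem
  have hue := (ω u).dx_le_one
  have hu' : u = slide v ((ω v).dx + h - (ω u).dx) := by
    apply up_injective
    rw [next_eq_slide, next_eq_slide, slide_slide] at hueq
    have := congrArg (fun z => slide z (-((ω u).dx : ℤ))) hueq
    simp only [slide_slide] at this
    rw [add_neg_cancel, slide_zero] at this
    rw [this, up_slide, sub_eq_add_neg]
  obtain ⟨k, hk⟩ := Int.eq_ofNat_of_zero_le (by omega : 0 ≤ ((ω v).dx : ℤ) + h - (ω u).dx)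
  rw [hk] at hu'
  rcases Nat.eq_zero_or_pos k with hk0 | hk0
  · rw [hk0, Nat.cast_zero, slide_zero] at hu'
    rw [hu'] at hk
    omega
  · rcases lt_trichotomy k g with hlt' | heq | hgt
    · exact slide_notMem_of_lt_gap hk0 hlt' (hu' ▸ hu)
    · rw [heq] at hu'
      rw [hu'] at hk
      omega
    · omega

lemma slide_gap_next [NeZero n] [NeZero m] {ω : CRSF n m} {S : Set (Torus n m)}
    (hS : Set.BijOn ω.next S S) {v : Torus n m} (hv : v ∈ S) :
    slide (ω.next v) (gap S (ω.next v)) = ω.next (slide v (gap S v)) := by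
  rw [gap_next hS hv, next_slide]

lemma slide_gap_iterate [NeZero n] [NeZero m] {ω : CRSF n m} {S : Set (Torus n m)}
    (hS : Set.BijOn ω.next S S) {v : Torus n m} (hv : v ∈ S) (t : ℕ) :
    slide (ω.next^[t] v) (gap S (ω.next^[t] v)) = ω.next^[t] (slide v (gap S v)) := by
  induction t with
  | zero => rfl
  | succ t ih =>
    rw [Function.iterate_succ_apply', Function.iterate_succ_apply', ← ih,
      slide_gap_next hS (hS.mapsTo.iterate t hv)]

lemma gap_iterate [NeZero n] [NeZero m] {ω : CRSF n m} {S : Set (Torus n m)}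
    (hS : Set.BijOn ω.next S S) {v : Torus n m} (hv : v ∈ S) (t : ℕ) :
    (gap S (ω.next^[t] v) : ℤ) = gap S v + ∑ i ∈ Finset.range t,
      (((ω (ω.next^[i] (slide v (gap S v)))).dx : ℤ) - ((ω (ω.next^[i] v)).dx : ℤ)) := by
  induction t with
  | zero => simp
  | succ t ih =>
    rw [Function.iterate_succ_apply', gap_next hS (hS.mapsTo.iterate t hv),
      slide_gap_iterate hS hv, ih, Finset.sum_range_succ]
    ring

/-- The regions to the right of the vertices of `S` are disjoint. -/
lemma sum_gap_le [NeZero n] [NeZero m] {S : Set (Torus n m)} {T : ℕ} (f : ℕ → Torus n m)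
    (hf : ∀ t < T, f t ∈ S) (hinj : Set.InjOn f (Set.Iio T)) :
    ∑ t ∈ Finset.range T, gap S (f t) ≤ n * m := by
  have hcard : (Finset.univ : Finset (Torus n m)).card = n * m := by
    rw [Finset.card_univ, Fintype.card_prod, ZMod.card, ZMod.card]
  have key : ∀ t < T, ∀ s < T, ∀ d e : ℕ, d ≤ e → e < gap S (f s) →
      slide (f t) d = slide (f s) e → t = s ∧ d = e := by
    intro t ht s hs d e hde he h
    have h1 : f t = slide (f s) ((e - d : ℕ) : ℤ) := by
      have := congrArg (fun z => slide z (-(d : ℤ))) h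
      simp only [slide_slide] at this
      rw [add_neg_cancel, slide_zero] at this
      rw [this, Nat.cast_sub hde, sub_eq_add_neg]
    have h2 : e - d = 0 := by
      by_contra hne
      exact slide_notMem_of_lt_gap (by omega) (by omega) (h1 ▸ hf t ht)
    rw [h2, Nat.cast_zero, slide_zero] at h1
    exact ⟨hinj ht hs h1, by omega⟩
  calc ∑ t ∈ Finset.range T, gap S (f t)
      = ((Finset.range T).sigma fun t => Finset.range (gap S (f t))).card := by
        rw [Finset.card_sigma]; simp
    _ ≤ (Finset.univ : Finset (Torus n m)).card := by
        refine Finset.card_le_card_of_injOn (fun x => slide (f x.1) x.2)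
          (fun _ _ => Finset.mem_coe.2 (Finset.mem_univ _)) ?_
        rintro ⟨t, d⟩ h1 ⟨s, e⟩ h2 h
        simp only [Finset.coe_sigma, Set.mem_sigma_iff, Finset.mem_coe, Finset.mem_range]
          at h1 h2 h
        rcases le_total d e with hde | hde
        · obtain ⟨rfl, rfl⟩ := key t h1.1 s h2.1 d e hde h2.2 h; rfl
        · obtain ⟨rfl, rfl⟩ := key s h2.1 t h1.1 e d hde h1.2 h.symm; rfl
    _ = n * m := hcard

/-! ### Cycles as invariant sets, and adjacent vertices of two cycles. -/

lemma IsCycle.subset_periodicPts {ω : CRSF n m} {S : Set (Torus n m)} (h : ω.IsCycle S) :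
    S ⊆ Function.periodicPts ω.next := by
  obtain ⟨v, hv, rfl⟩ := h
  rintro _ ⟨k, rfl⟩
  exact (Function.bijOn_periodicPts ω.next).mapsTo.iterate k hv

lemma IsCycle.mapsTo {ω : CRSF n m} {S : Set (Torus n m)} (h : ω.IsCycle S) :
    Set.MapsTo ω.next S S := by
  obtain ⟨v, hv, rfl⟩ := h
  rintro _ ⟨k, rfl⟩
  exact ⟨k + 1, Function.iterate_succ_apply' _ _ _⟩

lemma IsCycle.surjOn {ω : CRSF n m} {S : Set (Torus n m)} (h : ω.IsCycle S) :
    Set.SurjOn ω.next S S := by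
  obtain ⟨v, ⟨p, hp, hv⟩, rfl⟩ := h
  rintro _ ⟨k, rfl⟩
  refine ⟨_, ⟨k + p - 1, rfl⟩, ?_⟩
  rw [← Function.iterate_succ_apply' ω.next, show (k + p - 1).succ = k + p by omega,
    Function.iterate_add_apply, hv.eq]

lemma IsCycle.nonempty {ω : CRSF n m} {S : Set (Torus n m)} (h : ω.IsCycle S) : S.Nonempty := by
  obtain ⟨v, _, rfl⟩ := h
  exact ⟨v, 0, rfl⟩

lemma IsCycle.bijOn_union {ω : CRSF n m} {S₁ S₂ : Set (Torus n m)} (h₁ : ω.IsCycle S₁)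
    (h₂ : ω.IsCycle S₂) : Set.BijOn ω.next (S₁ ∪ S₂) (S₁ ∪ S₂) :=
  ⟨(IsCycle.mapsTo h₁).union_union (IsCycle.mapsTo h₂),
    (Function.bijOn_periodicPts ω.next).injOn.mono
      (Set.union_subset (IsCycle.subset_periodicPts h₁) (IsCycle.subset_periodicPts h₂)),
    (IsCycle.surjOn h₁).union_union (IsCycle.surjOn h₂)⟩

/-- Two invariant sets of vertices meet a common antidiagonal. -/
lemma exists_slide_mem [NeZero n] [NeZero m] {ω : CRSF n m} {S₁ S₂ : Set (Torus n m)}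
    (hS : Set.MapsTo ω.next S₂ S₂) (h₁ : S₁.Nonempty) (h₂ : S₂.Nonempty) :
    ∃ d : ℕ, ∃ v ∈ S₂, 1 ≤ d ∧ slide v d ∈ S₁ := by
  obtain ⟨u, hu⟩ := h₁
  obtain ⟨v, hv⟩ := h₂
  set a := (u.1 - v.1).val with ha
  set b := (u.2 - v.2).val with hb
  have ha' : (a : ZMod n) = u.1 - v.1 := ZMod.natCast_zmod_val _
  have hb' : (b : ZMod m) = u.2 - v.2 := ZMod.natCast_zmod_val _
  set E := ∑ i ∈ Finset.range (a + b), (ω (ω.next^[i] v)).dx with hE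
  set N := ∑ i ∈ Finset.range (a + b), (ω (ω.next^[i] v)).dy with hN
  have hEN : E + N = a + b := by
    rw [hE, hN, ← Finset.sum_add_distrib]
    simp [Step.dx_add_dy]
  have hnm : 1 ≤ n * m := Nat.mul_pos (NeZero.pos n) (NeZero.pos m)
  have hE0 : E ≤ n * m * E := Nat.le_mul_of_pos_left _ hnm
  -- After `a + b` steps the walk from `v` is on the antidiagonal of `u`, at signed distance `a -
  -- E`; the multiple of `n * m` makes the distance positive.
  refine ⟨n * m * (E + 1) + a - E, ω.next^[a + b] v, hS.iterate _ hv, ?_, ?_⟩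
  · have : n * m * (E + 1) = n * m * E + n * m := by ring
    omega
  · have hN' : (N : ZMod m) = a + b - E := by
      rw [eq_sub_iff_add_eq, add_comm]; exact_mod_cast congrArg (Nat.cast (R := ZMod m)) hEN
    have hcast : ((n * m * (E + 1) + a - E : ℕ) : ℤ) = n * m * (E + 1) + a - E := by
      rw [Nat.cast_sub (by nlinarith)]; push_cast; ring
    rw [hcast]
    have : slide (ω.next^[a + b] v) (n * m * (E + 1) + a - E) = u := by
      rw [iterate_next, ← hE, ← hN]
      ext
      · simp [slide, ha']
      · simp [slide, ha', hN', hb']; ring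
    exact this ▸ hu

/-- Take a pair at minimal positive distance. A vertex of either set strictly between its members
would give a closer pair. -/
lemma exists_adjacent [NeZero n] [NeZero m] {ω : CRSF n m} {S₁ S₂ : Set (Torus n m)}
    (hS : Set.MapsTo ω.next S₂ S₂) (h₁ : S₁.Nonempty) (h₂ : S₂.Nonempty) :
    ∃ v ∈ S₂, slide v (gap (S₁ ∪ S₂) v) ∈ S₁ := by
  classical
  have hex := exists_slide_mem hS h₁ h₂
  obtain ⟨v, hv, hd1, hd⟩ := Nat.find_spec hex
  have hmin := fun k => Nat.find_min hex (m := k)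
  generalize Nat.find hex = d at hv hd1 hd hmin
  refine ⟨v, hv, ?_⟩
  rw [gap_eq hd1 (Or.inl hd)]
  · exact hd
  · rintro h h1 hlt (hmem | hmem)
    · exact hmin h hlt ⟨v, hv, h1, hmem⟩
    · refine hmin (d - h) (by omega) ⟨slide v h, hmem, by omega, ?_⟩
      rw [slide_slide, Nat.cast_sub hlt.le, add_sub_cancel]
      exact hd

/-! ### Walks coded by their step sequences. -/

/-- The position at time `t` of the walk from `v` with the steps `c`. -/
def walkPos {T : ℕ} (v : Torus n m) (c : Fin T → Step) (t : Fin T) : Torus n m :=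
  (v.1 + ((∑ i ∈ Finset.Iio t, (c i).dx : ℕ) : ZMod n),
    v.2 + ((∑ i ∈ Finset.Iio t, (c i).dy : ℕ) : ZMod m))

lemma sum_Iio_val {M : Type*} [AddCommMonoid M] {T : ℕ} (t : Fin T) (f : ℕ → M) :
    ∑ i ∈ Finset.Iio t, f i = ∑ i ∈ Finset.range t, f i := by
  rw [← Nat.Iio_eq_range, ← Fin.map_valEmbedding_Iio, Finset.sum_map]
  rfl

lemma walkPos_eq_iterate {T : ℕ} (ω : CRSF n m) (v : Torus n m) (t : Fin T) :
    walkPos v (fun i : Fin T => ω (ω.next^[(i : ℕ)] v)) t = ω.next^[(t : ℕ)] v := by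
  rw [iterate_next, walkPos, sum_Iio_val t fun i => (ω (ω.next^[i] v)).dx,
    sum_Iio_val t fun i => (ω (ω.next^[i] v)).dy]

lemma sum_Iio_succ {M : Type*} [AddCommMonoid M] {T : ℕ} (t : Fin T) (f : Fin (T + 1) → M) :
    ∑ i ∈ Finset.Iio t.succ, f i = f 0 + ∑ i ∈ Finset.Iio t, f i.succ := by
  have h1 : ∀ {k : ℕ} (t : Fin k), Finset.Iio t = Finset.univ.filter (· < t) := by
    intro k t; ext; simp
  rw [h1, h1, Finset.sum_filter, Finset.sum_filter, Fin.sum_univ_succ]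
  simp

/-- The distance between two walks, started at distance `x`, whose steps are recorded by `c`. -/
def walkGap {T : ℕ} (x : ℤ) (c : Fin T → Step × Step) (t : Fin T) : ℤ :=
  x + ∑ i ∈ Finset.Iio t, (((c i).2.dx : ℤ) - ((c i).1.dx : ℤ))

lemma walkGap_cons_zero {T : ℕ} (x : ℤ) (a : Step × Step) (c : Fin T → Step × Step) :
    walkGap x (Fin.cons a c : Fin (T + 1) → Step × Step) 0 = x := by
  have : Finset.Iio (0 : Fin (T + 1)) = ∅ := by ext; simp
  simp [walkGap, this]

lemma walkGap_cons_succ {T : ℕ} (x : ℤ) (a : Step × Step) (c : Fin T → Step × Step) (t : Fin T) :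
    walkGap x (Fin.cons a c : Fin (T + 1) → Step × Step) t.succ =
      walkGap (x + ((a.2.dx : ℤ) - (a.1.dx : ℤ))) c t := by
  simp only [walkGap, sum_Iio_succ, Fin.cons_zero, Fin.cons_succ]
  ring

/-! ### Positive lazy walks of small area. -/

/-- A bounded superharmonic function for the lazy walk killed at the origin. -/
noncomputable def barrier (w : ℝ) (x : ℝ) : ℝ := 3 * w ^ 2 - (max (w - x) 0) ^ 2

lemma barrier_le (w x : ℝ) : barrier w x ≤ 3 * w ^ 2 := by
  unfold barrier; nlinarith [sq_nonneg (max (w - x) 0)]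

lemma le_barrier {w x : ℝ} (hw : 0 ≤ w) (hx : 0 ≤ x) : 2 * w ^ 2 ≤ barrier w x := by
  unfold barrier
  have h0 : 0 ≤ max (w - x) 0 := le_max_right _ _
  have h1 : max (w - x) 0 ≤ w := max_le (by linarith) hw
  nlinarith

/-- Up to height `w`, concavity of the barrier gains `1` out of at most `12 * w ^ 2`. Above `w` the
barrier is flat, but the exponential penalty for area already supplies the same factor. -/
lemma barrier_superharmonic {w x : ℝ} (hw : 0 < w) (hx : 1 ≤ x) :
    Real.exp (-(x / (12 * w ^ 3))) *
        (barrier w (x - 1) + 2 * barrier w x + barrier w (x + 1)) ≤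
      4 * Real.exp (-(1 / (12 * w ^ 2))) * barrier w x := by
  have hb := le_barrier hw.le (by linarith : (0 : ℝ) ≤ x)
  have hb3 := barrier_le w x
  have hbpos : 0 < barrier w x := lt_of_lt_of_le (by positivity) hb
  rcases le_or_gt x w with h | h
  · have h1 : barrier w (x - 1) + 2 * barrier w x + barrier w (x + 1) ≤ 4 * barrier w x - 1 := by
      unfold barrier
      rw [max_eq_left (by linarith : (0 : ℝ) ≤ w - (x - 1)),
        max_eq_left (by linarith : (0 : ℝ) ≤ w - x)]
      rcases le_total 0 (w - (x + 1)) with h2 | h2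
      · rw [max_eq_left h2]; nlinarith
      · rw [max_eq_right h2]; nlinarith
    have h2 : 1 - 1 / (12 * w ^ 2) ≤ Real.exp (-(1 / (12 * w ^ 2))) := by
      have := Real.add_one_le_exp (-(1 / (12 * w ^ 2))); linarith
    have h3 : 4 * barrier w x - 1 ≤ 4 * Real.exp (-(1 / (12 * w ^ 2))) * barrier w x := by
      have h4 : 4 * barrier w x * (1 / (12 * w ^ 2)) ≤ 1 := by
        rw [mul_one_div, div_le_one (by positivity)]; linarith
      nlinarith
    have h5 : 0 < 4 * Real.exp (-(1 / (12 * w ^ 2))) * barrier w x := by positivity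
    have h6 : Real.exp (-(x / (12 * w ^ 3))) ≤ 1 := by
      rw [Real.exp_le_one_iff, neg_nonpos]
      have : 0 ≤ x := by linarith
      positivity
    calc _ ≤ Real.exp (-(x / (12 * w ^ 3))) *
          (4 * Real.exp (-(1 / (12 * w ^ 2))) * barrier w x) := by
          gcongr; exact h1.trans h3
      _ ≤ 1 * (4 * Real.exp (-(1 / (12 * w ^ 2))) * barrier w x) := by gcongr
      _ = _ := one_mul _
  · have h1 : barrier w (x - 1) + 2 * barrier w x + barrier w (x + 1) ≤ 4 * barrier w x := by
      have : barrier w x = 3 * w ^ 2 := by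
        unfold barrier; rw [max_eq_right (by linarith)]; ring
      have := barrier_le w (x - 1)
      have := barrier_le w (x + 1)
      linarith
    have h2 : Real.exp (-(x / (12 * w ^ 3))) ≤ Real.exp (-(1 / (12 * w ^ 2))) := by
      rw [Real.exp_le_exp, neg_le_neg_iff, div_le_div_iff₀ (by positivity) (by positivity)]
      have : 0 < w ^ 2 := by positivity
      nlinarith
    calc _ ≤ Real.exp (-(x / (12 * w ^ 3))) * (4 * barrier w x) := by gcongr
      _ ≤ Real.exp (-(1 / (12 * w ^ 2))) * (4 * barrier w x) := by gcongr
      _ = _ := by ring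

/-- The exponential weight of a pair of walks that have not met. -/
noncomputable def gapWeight (w : ℝ) {T : ℕ} (x : ℤ) (c : Fin T → Step × Step) : ℝ :=
  ∏ t, if 1 ≤ walkGap x c t then Real.exp (-((walkGap x c t : ℝ) / (12 * w ^ 3))) else 0

lemma gapWeight_nonneg (w : ℝ) {T : ℕ} (x : ℤ) (c : Fin T → Step × Step) :
    0 ≤ gapWeight w x c := by
  refine Finset.prod_nonneg fun t _ => ?_
  split_ifs <;> positivity

lemma gapWeight_cons (w : ℝ) {T : ℕ} (x : ℤ) (a : Step × Step) (c : Fin T → Step × Step) :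
    gapWeight w x (Fin.cons a c : Fin (T + 1) → Step × Step) =
      (if 1 ≤ x then Real.exp (-((x : ℝ) / (12 * w ^ 3))) else 0) *
        gapWeight w (x + ((a.2.dx : ℤ) - (a.1.dx : ℤ))) c := by
  simp only [gapWeight, Fin.prod_univ_succ, walkGap_cons_zero, walkGap_cons_succ]

/-- Conditioning on the first pair of steps: of the four pairs, one shrinks the gap, two keep it and
one widens it. -/
lemma sum_gapWeight_succ (w : ℝ) (T : ℕ) (x : ℤ) :
    ∑ c : Fin (T + 1) → Step × Step, gapWeight w x c =
      (if 1 ≤ x then Real.exp (-((x : ℝ) / (12 * w ^ 3))) else 0) *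
        ((∑ c : Fin T → Step × Step, gapWeight w (x - 1) c) +
          2 * (∑ c : Fin T → Step × Step, gapWeight w x c) +
          ∑ c : Fin T → Step × Step, gapWeight w (x + 1) c) := by
  rw [← (Fin.consEquiv fun _ : Fin (T + 1) => Step × Step).sum_comp, Fintype.sum_prod_type]
  simp only [Fin.consEquiv, Equiv.coe_fn_mk, gapWeight_cons, ← Finset.mul_sum]
  congr 1
  rw [Fintype.sum_prod_type]
  have h2 : ∀ f : Step → ℝ, ∑ s, f s = f Step.east + f Step.north := by
    intro f
    change ∑ s ∈ {Step.east, Step.north}, f s = _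
    exact Finset.sum_pair (by simp)
  simp only [h2, Step.dx]
  norm_num
  ring_nf

/-- Iterating superharmonicity loses a factor `exp(-1/(12 w²))` per step; the lower bound `2 * w ^
2` on the barrier starts the induction. -/
lemma sum_gapWeight_le {w : ℝ} (hw : 0 < w) (T : ℕ) (x : ℤ) (hx : 0 ≤ x) :
    2 * w ^ 2 * ∑ c : Fin T → Step × Step, gapWeight w x c ≤
      (4 * Real.exp (-(1 / (12 * w ^ 2)))) ^ T * barrier w x := by
  induction T generalizing x with
  | zero => simpa [gapWeight] using le_barrier hw.le (by exact_mod_cast hx : (0 : ℝ) ≤ x)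
  | succ T ih =>
    rw [sum_gapWeight_succ]
    split_ifs with h
    · have h1 := ih (x - 1) (by omega)
      have h2 := ih x hx
      have h3 := ih (x + 1) (by omega)
      have h4 := barrier_superharmonic hw (by exact_mod_cast h : (1 : ℝ) ≤ x)
      push_cast at h1 h3
      calc _ = Real.exp (-((x : ℝ) / (12 * w ^ 3))) *
            (2 * w ^ 2 * (∑ c : Fin T → Step × Step, gapWeight w (x - 1) c) +
              2 * (2 * w ^ 2 * (∑ c : Fin T → Step × Step, gapWeight w x c)) +
              2 * w ^ 2 * ∑ c : Fin T → Step × Step, gapWeight w (x + 1) c) := by ring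
        _ ≤ Real.exp (-((x : ℝ) / (12 * w ^ 3))) *
            ((4 * Real.exp (-(1 / (12 * w ^ 2)))) ^ T * barrier w (x - 1) +
              2 * ((4 * Real.exp (-(1 / (12 * w ^ 2)))) ^ T * barrier w x) +
              (4 * Real.exp (-(1 / (12 * w ^ 2)))) ^ T * barrier w (x + 1)) := by
            gcongr
        _ = (4 * Real.exp (-(1 / (12 * w ^ 2)))) ^ T * (Real.exp (-((x : ℝ) / (12 * w ^ 3))) *
            (barrier w (x - 1) + 2 * barrier w x + barrier w (x + 1))) := by ring
        _ ≤ (4 * Real.exp (-(1 / (12 * w ^ 2)))) ^ T *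
            (4 * Real.exp (-(1 / (12 * w ^ 2))) * barrier w x) := by gcongr
        _ = _ := by ring
    · have := le_barrier hw.le (by exact_mod_cast hx : (0 : ℝ) ≤ x)
      have h5 : 0 ≤ barrier w x := le_trans (by positivity) this
      simp only [zero_mul, mul_zero]
      positivity

open Classical in
/-- The pairs of step sequences whose walks do not meet and enclose a region of area at most `A`. -/
noncomputable def narrowPairs (T : ℕ) (x A : ℕ) : Finset (Fin T → Step × Step) :=
  Finset.univ.filter fun c =>
    (∀ t, 1 ≤ walkGap (x : ℤ) c t) ∧ ∑ t, walkGap (x : ℤ) c t ≤ (A : ℤ)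

/-- An exponential Markov inequality: each admissible pair has weight at least `exp(-A/(12 w³))`,
while the total weight decays at rate `1/(12 w²)` per step. -/
lemma card_narrowPairs_le {T A : ℕ} (hT : 0 < T) (hA : 0 < A) (x : ℕ) :
    ((narrowPairs T x A).card : ℝ) ≤
      4 ^ T * (2 * Real.exp (-((T : ℝ) ^ 3 / (96 * (A : ℝ) ^ 2)))) := by
  have hT' : (0 : ℝ) < T := by exact_mod_cast hT
  have hA' : (0 : ℝ) < A := by exact_mod_cast hA
  -- Twice the mean gap: the area penalty then cancels half of the decay, leaving `T / (24 w²) = T³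
  -- / (96 A²)`.
  set w : ℝ := 2 * A / T with hw_def
  have hw : 0 < w := by positivity
  have h1 : ∀ c ∈ narrowPairs T x A,
      Real.exp (-((A : ℝ) / (12 * w ^ 3))) ≤ gapWeight w (x : ℤ) c := by
    intro c hc
    obtain ⟨hpos, hsum⟩ := (Finset.mem_filter.1 hc).2
    have : gapWeight w (x : ℤ) c =
        Real.exp (-((∑ t, (walkGap (x : ℤ) c t : ℝ)) / (12 * w ^ 3))) := by
      rw [gapWeight, Finset.sum_div, ← Finset.sum_neg_distrib, Real.exp_sum]
      exact Finset.prod_congr rfl fun t _ => if_pos (hpos t)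
    rw [this, Real.exp_le_exp, neg_le_neg_iff]
    have : ∑ t, (walkGap (x : ℤ) c t : ℝ) ≤ A := by exact_mod_cast hsum
    gcongr
  have h2 : ((narrowPairs T x A).card : ℝ) * Real.exp (-((A : ℝ) / (12 * w ^ 3))) ≤
      ∑ c : Fin T → Step × Step, gapWeight w (x : ℤ) c := by
    calc _ = ∑ c ∈ narrowPairs T x A, Real.exp (-((A : ℝ) / (12 * w ^ 3))) := by
          rw [Finset.sum_const, nsmul_eq_mul]
      _ ≤ ∑ c ∈ narrowPairs T x A, gapWeight w (x : ℤ) c := Finset.sum_le_sum h1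
      _ ≤ _ := Finset.sum_le_univ_sum_of_nonneg fun c => gapWeight_nonneg _ _ _
  have h3 := sum_gapWeight_le hw T (x : ℤ) (by positivity)
  have h4 : ∑ c : Fin T → Step × Step, gapWeight w (x : ℤ) c ≤
      (4 * Real.exp (-(1 / (12 * w ^ 2)))) ^ T * 2 := by
    have h5 := barrier_le w ((x : ℤ) : ℝ)
    have h6 : 2 * w ^ 2 * ∑ c : Fin T → Step × Step, gapWeight w (x : ℤ) c ≤
        2 * w ^ 2 * ((4 * Real.exp (-(1 / (12 * w ^ 2)))) ^ T * 2) := by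
      refine h3.trans ?_
      calc _ ≤ (4 * Real.exp (-(1 / (12 * w ^ 2)))) ^ T * (4 * w ^ 2) := by
            gcongr
            nlinarith [sq_nonneg w]
        _ = _ := by ring
    exact le_of_mul_le_mul_left h6 (by positivity)
  have h7 := h2.trans h4
  rw [mul_pow, ← Real.exp_nat_mul] at h7
  have h8 : ((narrowPairs T x A).card : ℝ) =
      ((narrowPairs T x A).card : ℝ) * Real.exp (-((A : ℝ) / (12 * w ^ 3))) *
        Real.exp ((A : ℝ) / (12 * w ^ 3)) := by
    rw [mul_assoc, ← Real.exp_add]; simp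
  rw [h8]
  calc _ ≤ 4 ^ T * Real.exp ((T : ℝ) * -(1 / (12 * w ^ 2))) * 2 *
        Real.exp ((A : ℝ) / (12 * w ^ 3)) := by gcongr
    _ = 4 ^ T * (2 * Real.exp ((T : ℝ) * -(1 / (12 * w ^ 2)) + (A : ℝ) / (12 * w ^ 3))) := by
        rw [Real.exp_add]; ring
    _ = _ := by
        congr 3
        rw [hw_def]
        field_simp
        norm_num

/-! ### Two disjoint long cycles. -/

/-- The event that some cycle has fewer than `T` vertices. -/
def shortCycle (n m T : ℕ) : Set (CRSF n m) :=
  {ω | ∃ v ∈ Function.periodicPts ω.next, Function.minimalPeriod ω.next v < T}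

/-- Two disjoint long cycles follow a pair of walks that stay close to each other. -/
lemma exists_narrowPairs [NeZero n] [NeZero m] {T : ℕ} (hT : 0 < T) {ω : CRSF n m}
    (hω : ω ∈ twoDisjointCycles n m \ shortCycle n m T) :
    ∃ v : Torus n m, ∃ g ∈ Finset.Icc 1 (n * m), ∃ c ∈ narrowPairs T g (n * m),
      Function.Injective (Sum.elim (walkPos v fun i => (c i).1)
        (walkPos (slide v g) fun i => (c i).2)) ∧
      ∀ i, ω (Sum.elim (walkPos v fun i => (c i).1) (walkPos (slide v g) fun i => (c i).2) i) =
        Sum.elim (fun i => (c i).1) (fun i => (c i).2) i := by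
  obtain ⟨⟨S₁, S₂, h₁, h₂, hdisj⟩, hlong⟩ := hω
  have hper : ∀ v ∈ Function.periodicPts ω.next, T ≤ Function.minimalPeriod ω.next v := by
    intro v hv
    by_contra! hlt
    exact hlong ⟨v, hv, hlt⟩
  have hinj : ∀ v ∈ Function.periodicPts ω.next,
      Set.InjOn (fun t : ℕ => ω.next^[t] v) (Set.Iio T) := fun v hv =>
    (Function.iterate_injOn_Iio_minimalPeriod (f := ω.next) (x := v)).mono
      (Set.Iio_subset_Iio (hper v hv))
  have hbij := IsCycle.bijOn_union h₁ h₂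
  obtain ⟨v, hv, hw⟩ := exists_adjacent (IsCycle.mapsTo h₂) (IsCycle.nonempty h₁)
    (IsCycle.nonempty h₂)
  set S := S₁ ∪ S₂ with hS
  have hvS : v ∈ S := Or.inr hv
  set w := slide v (gap S v) with hw_def
  have hvp := IsCycle.subset_periodicPts h₂ hv
  have hwp := IsCycle.subset_periodicPts h₁ hw
  have hmemS : ∀ t, ω.next^[t] v ∈ S := fun t => hbij.mapsTo.iterate t hvS
  have harea := sum_gap_le (fun t => ω.next^[t] v) (fun t _ => hmemS t) (hinj v hvp)
  have hgap : ∀ t : Fin T, walkGap (gap S v : ℤ)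
      (fun i : Fin T => (ω (ω.next^[(i : ℕ)] v), ω (ω.next^[(i : ℕ)] w))) t =
        gap S (ω.next^[(t : ℕ)] v) := by
    intro t
    rw [gap_iterate hbij hvS, walkGap, ← hw_def, sum_Iio_val t fun i =>
      ((ω (ω.next^[i] w)).dx : ℤ) - ((ω (ω.next^[i] v)).dx : ℤ)]
  have hpos : ∀ u : Torus n m, walkPos u (fun i : Fin T => ω (ω.next^[(i : ℕ)] u)) =
      fun t : Fin T => ω.next^[(t : ℕ)] u := fun u => funext (walkPos_eq_iterate ω u)
  refine ⟨v, gap S v, Finset.mem_Icc.2 ⟨(gap_spec hvS).1, ?_⟩,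
    fun i => (ω (ω.next^[(i : ℕ)] v), ω (ω.next^[(i : ℕ)] w)), ?_, ?_, ?_⟩
  · exact (Finset.single_le_sum (f := fun t => gap S (ω.next^[t] v)) (fun _ _ => Nat.zero_le _)
      (Finset.mem_range.2 hT)).trans harea
  · refine Finset.mem_filter.2 ⟨Finset.mem_univ _, fun t => ?_, ?_⟩
    · rw [hgap]
      exact_mod_cast (gap_spec (hmemS t)).1
    · simp only [hgap]
      rw [← Finset.sum_range fun t => (gap S (ω.next^[t] v) : ℤ)]
      exact_mod_cast harea
  · simp only [hpos, ← hw_def]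
    -- Each strand is self-avoiding up to time `T` because its period is at least `T`; the strands
    -- avoid each other because the cycles are disjoint.
    refine Function.Injective.sumElim (fun s t h => Fin.ext (hinj v hvp s.2 t.2 h))
      (fun s t h => Fin.ext (hinj w hwp s.2 t.2 h)) (fun s t h => ?_)
    exact Set.disjoint_left.1 hdisj ((IsCycle.mapsTo h₁).iterate _ hw)
      (h ▸ (IsCycle.mapsTo h₂).iterate _ hv)
  · simp only [hpos, ← hw_def]
    rintro (i | i) <;> rfl

lemma crsfMeasure_long_le [NeZero n] [NeZero m] {T : ℕ} (hT : 0 < T) :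
    (crsfMeasure n m).real (twoDisjointCycles n m \ shortCycle n m T) ≤
      ((n : ℝ) * m) ^ 2 * (2 * Real.exp (-((T : ℝ) ^ 3 / (96 * ((n : ℝ) * m) ^ 2)))) := by
  classical
  set B : ℝ := 2 * Real.exp (-((T : ℝ) ^ 3 / (96 * ((n : ℝ) * m) ^ 2))) with hB
  let E : Torus n m × ℕ → Set (CRSF n m) := fun x => {ω | ∃ c ∈ narrowPairs T x.2 (n * m),
      Function.Injective (Sum.elim (walkPos x.1 fun i => (c i).1)
        (walkPos (slide x.1 x.2) fun i => (c i).2)) ∧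
      ∀ i, ω (Sum.elim (walkPos x.1 fun i => (c i).1)
        (walkPos (slide x.1 x.2) fun i => (c i).2) i) =
        Sum.elim (fun i => (c i).1) (fun i => (c i).2) i}
  have hsub : twoDisjointCycles n m \ shortCycle n m T ⊆
      ⋃ x ∈ (Finset.univ : Finset (Torus n m)) ×ˢ Finset.Icc 1 (n * m), E x := by
    intro ω hω
    obtain ⟨v, g, hg, h⟩ := exists_narrowPairs hT hω
    simp only [Set.mem_iUnion]
    exact ⟨(v, g), Finset.mem_product.2 ⟨Finset.mem_univ _, hg⟩, h⟩
  have hE : ∀ x, (crsfMeasure n m).real (E x) ≤ B := by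
    intro x
    have h1 := crsfMeasure_le_card_codes (n := n) (m := m) (narrowPairs T x.2 (n * m))
      (fun c => Sum.elim (walkPos x.1 fun i => (c i).1) (walkPos (slide x.1 x.2) fun i => (c i).2))
      (fun c => Sum.elim (fun i => (c i).1) (fun i => (c i).2)) (E x) (fun ω hω => hω)
    have h2 := card_narrowPairs_le hT (Nat.mul_pos (NeZero.pos n) (NeZero.pos m)) x.2
    rw [Nat.cast_mul, ← hB] at h2
    refine h1.trans ?_
    -- The `2 * T` visited vertices are distinct, so the cylinder probability `4 ^ (-T)` cancels the
    -- factor `4 ^ T` in the count.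
    rw [Fintype.card_sum, Fintype.card_fin, ← two_mul, pow_mul]
    calc _ ≤ 4 ^ T * B * (((1 : ℝ) / 2) ^ 2) ^ T := by gcongr
      _ = (4 * ((1 : ℝ) / 2) ^ 2) ^ T * B := by rw [mul_pow]; ring
      _ = B := by norm_num
  calc (crsfMeasure n m).real (twoDisjointCycles n m \ shortCycle n m T) ≤ _ :=
        measureReal_mono hsub (measure_ne_top _ _)
    _ ≤ ∑ x ∈ (Finset.univ : Finset (Torus n m)) ×ˢ Finset.Icc 1 (n * m),
          (crsfMeasure n m).real (E x) := measureReal_biUnion_finset_le _ _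
    _ ≤ ∑ x ∈ (Finset.univ : Finset (Torus n m)) ×ˢ Finset.Icc 1 (n * m), B :=
        Finset.sum_le_sum fun x _ => hE x
    _ = _ := by
        rw [Finset.sum_const, Finset.card_product, Finset.card_univ, Fintype.card_prod, ZMod.card,
          ZMod.card, Nat.card_Icc, nsmul_eq_mul]
        push_cast [Nat.add_sub_cancel]
        ring

/-! ### Short cycles and closed walks through the axes. -/

lemma val_add_one {k : ℕ} [NeZero k] {x : ZMod k} (h : x + 1 ≠ 0) : (x + 1).val = x.val + 1 := by
  have h1 : x + 1 = ((x.val + 1 : ℕ) : ZMod k) := by simp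
  have h2 := ZMod.val_lt x
  rw [h1, ZMod.val_natCast, Nat.mod_eq_of_lt]
  refine lt_of_le_of_ne h2 fun h3 => h ?_
  rw [h1, show x.val + 1 = k from h3, ZMod.natCast_self]

/-- Every cycle meets the union of the coordinate axes. -/
lemma exists_iterate_axis [NeZero n] [NeZero m] {ω : CRSF n m} {v : Torus n m}
    (hv : v ∈ Function.periodicPts ω.next) :
    ∃ t, (ω.next^[t] v).1 = 0 ∨ (ω.next^[t] v).2 = 0 := by
  by_contra! hne
  -- Off the axes no coordinate wraps around, so the sum of the representatives grows by one per
  -- step, which periodicity forbids.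
  have h1 : ∀ t, (ω.next^[t] v).1.val + (ω.next^[t] v).2.val = v.1.val + v.2.val + t := by
    intro t
    induction t with
    | zero => rfl
    | succ t ih =>
      have h := hne (t + 1)
      rw [Function.iterate_succ_apply'] at h ⊢
      generalize ω.next^[t] v = u at h ih
      unfold CRSF.next at h ⊢
      cases hs : ω u with
      | east =>
        simp only [hs, Step.target] at h ⊢
        rw [val_add_one h.1]; omega
      | north =>
        simp only [hs, Step.target] at h ⊢
        rw [val_add_one h.2]; omega
  obtain ⟨p, hp, hpv⟩ := hv
  have h2 := h1 p
  rw [hpv.eq] at h2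
  omega

open Classical in
/-- The step sequences of length `L` with `k` steps to the east. -/
noncomputable def eastCodes (L k : ℕ) : Finset (Fin L → Step) :=
  Finset.univ.filter fun c => ∑ i, (c i).dx = k

lemma card_eastCodes_le (L k : ℕ) : (eastCodes L k).card ≤ L.choose k := by
  classical
  have h := Finset.card_powersetCard k (Finset.univ : Finset (Fin L))
  rw [Finset.card_univ, Fintype.card_fin] at h
  rw [← h]
  refine Finset.card_le_card_of_injOn (fun c => Finset.univ.filter fun i => c i = Step.east) ?_ ?_
  · intro c hc
    have hc' := (Finset.mem_filter.1 hc).2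
    rw [Finset.mem_coe, Finset.mem_powersetCard]
    refine ⟨Finset.subset_univ _, ?_⟩
    rw [Finset.card_filter, ← hc']
    refine Finset.sum_congr rfl fun i _ => ?_
    cases c i <;> simp [Step.dx]
  · intro c _ c' _ h
    funext i
    have := Finset.ext_iff.1 h i
    simp only [Finset.mem_filter, Finset.mem_univ, true_and] at this
    cases hc : c i <;> cases hc' : c' i <;> simp_all

/-- The homology classes of the closed walks of length less than `T`. -/
def shortClasses (n m T : ℕ) : Finset (ℕ × ℕ) :=
  (Finset.range T ×ˢ Finset.range T).filter fun x =>
    0 < x.1 * n + x.2 * m ∧ x.1 * n + x.2 * m < T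

lemma exists_closed_walk [NeZero n] [NeZero m] {T : ℕ} {ω : CRSF n m}
    (hω : ω ∈ shortCycle n m T) :
    ∃ v : Torus n m, (v.1 = 0 ∨ v.2 = 0) ∧ ∃ x ∈ shortClasses n m T,
      ∃ c ∈ eastCodes (x.1 * n + x.2 * m) (x.1 * n), Function.Injective (walkPos v c) ∧
        ∀ i, ω (walkPos v c i) = c i := by
  obtain ⟨v₀, hv₀, hlt⟩ := hω
  obtain ⟨t, ht⟩ := exists_iterate_axis hv₀
  have hv := (Function.bijOn_periodicPts ω.next).mapsTo.iterate t hv₀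
  have hL := Function.minimalPeriod_apply_iterate hv₀ t
  set v := ω.next^[t] v₀ with hv_def
  have hpos := Function.minimalPeriod_pos_of_mem_periodicPts hv
  have hclosed : ω.next^[Function.minimalPeriod ω.next v] v = v :=
    Function.iterate_minimalPeriod
  have hinj := Function.iterate_injOn_Iio_minimalPeriod (f := ω.next) (x := v)
  rw [← hL] at hlt
  generalize Function.minimalPeriod ω.next v = L at hlt hpos hclosed hinj
  rw [iterate_next] at hclosed
  have hx := congrArg Prod.fst hclosed
  have hy := congrArg Prod.snd hclosed
  simp only [add_eq_left, ZMod.natCast_eq_zero_iff] at hx hy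
  obtain ⟨a, ha⟩ := hx
  obtain ⟨b, hb⟩ := hy
  have hsum : n * a + m * b = L := by
    rw [← ha, ← hb, ← Finset.sum_add_distrib]
    simp [Step.dx_add_dy]
  have hn := NeZero.pos n
  have hm := NeZero.pos m
  have hLab : L = a * n + b * m := by rw [← hsum]; ring
  subst hLab
  refine ⟨v, ht, (a, b), ?_, fun i => ω (ω.next^[(i : ℕ)] v), ?_, ?_, ?_⟩
  · simp only [shortClasses, Finset.mem_filter, Finset.mem_product, Finset.mem_range]
    refine ⟨⟨?_, ?_⟩, hpos, hlt⟩ <;> nlinarith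
  · refine Finset.mem_filter.2 ⟨Finset.mem_univ _, ?_⟩
    rw [← Finset.sum_range fun i => (ω (ω.next^[i] v)).dx, ha, mul_comm]
  · intro s t h
    rw [walkPos_eq_iterate, walkPos_eq_iterate] at h
    exact Fin.ext (hinj s.2 t.2 h)
  · intro i
    rw [walkPos_eq_iterate]

lemma card_axes_le (n m : ℕ) [NeZero n] [NeZero m] :
    ((Finset.univ : Finset (Torus n m)).filter fun v => v.1 = 0 ∨ v.2 = 0).card ≤ n + m := by
  classical
  have h : ((Finset.univ : Finset (Torus n m)).filter fun v => v.1 = 0 ∨ v.2 = 0) ⊆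
      ((Finset.univ : Finset (ZMod n)).image fun x => (x, 0)) ∪
        ((Finset.univ : Finset (ZMod m)).image fun y => (0, y)) := by
    rintro ⟨x, y⟩ h
    simp only [Finset.mem_filter, Finset.mem_univ, true_and] at h
    rcases h with rfl | rfl <;> simp
  refine (Finset.card_le_card h).trans ((Finset.card_union_le _ _).trans ?_)
  refine add_le_add (Finset.card_image_le.trans ?_) (Finset.card_image_le.trans ?_) <;>
    simp [ZMod.card]

lemma crsfMeasure_shortCycle_le [NeZero n] [NeZero m] (T : ℕ) :
    (crsfMeasure n m).real (shortCycle n m T) ≤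
      ((n : ℝ) + m) * ∑ x ∈ shortClasses n m T,
        ((x.1 * n + x.2 * m).choose (x.1 * n) : ℝ) / 2 ^ (x.1 * n + x.2 * m) := by
  classical
  set F : ℕ × ℕ → ℝ := fun x =>
    ((x.1 * n + x.2 * m).choose (x.1 * n) : ℝ) / 2 ^ (x.1 * n + x.2 * m) with hF
  let V := (Finset.univ : Finset (Torus n m)).filter fun v => v.1 = 0 ∨ v.2 = 0
  let E : Torus n m → ℕ × ℕ → Set (CRSF n m) := fun v x =>
    {ω | ∃ c ∈ eastCodes (x.1 * n + x.2 * m) (x.1 * n), Function.Injective (walkPos v c) ∧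
        ∀ i, ω (walkPos v c i) = c i}
  have hsub : shortCycle n m T ⊆ ⋃ y ∈ V ×ˢ shortClasses n m T, E y.1 y.2 := by
    intro ω hω
    obtain ⟨v, hv, x, hx, h⟩ := exists_closed_walk hω
    simp only [Set.mem_iUnion]
    exact ⟨(v, x), Finset.mem_product.2 ⟨Finset.mem_filter.2 ⟨Finset.mem_univ _, hv⟩, hx⟩, h⟩
  have hE : ∀ v x, (crsfMeasure n m).real (E v x) ≤ F x := by
    intro v x
    have h1 := crsfMeasure_le_card_codes (n := n) (m := m)
      (eastCodes (x.1 * n + x.2 * m) (x.1 * n)) (fun c => walkPos v c) (fun c => c) (E v x)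
      (fun ω hω => hω)
    refine h1.trans ?_
    rw [Fintype.card_fin, one_div, inv_pow, ← div_eq_mul_inv]
    have h2 := card_eastCodes_le (x.1 * n + x.2 * m) (x.1 * n)
    exact div_le_div_of_nonneg_right (by exact_mod_cast h2) (by positivity)
  calc (crsfMeasure n m).real (shortCycle n m T) ≤ _ :=
        measureReal_mono hsub (measure_ne_top _ _)
    _ ≤ ∑ y ∈ V ×ˢ shortClasses n m T, (crsfMeasure n m).real (E y.1 y.2) :=
        measureReal_biUnion_finset_le _ _
    _ ≤ ∑ y ∈ V ×ˢ shortClasses n m T, F y.2 := Finset.sum_le_sum fun y _ => hE y.1 y.2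
    _ = V.card * ∑ x ∈ shortClasses n m T, F x := by
        rw [Finset.sum_product]; simp only [Finset.sum_const, nsmul_eq_mul]
    _ ≤ _ := by
        have h0 : 0 ≤ ∑ x ∈ shortClasses n m T, F x := Finset.sum_nonneg fun x _ => by
          rw [hF]; positivity
        have h1 : (V.card : ℝ) ≤ n + m := by exact_mod_cast card_axes_le n m
        exact mul_le_mul_of_nonneg_right h1 h0

end TorusCRSF

/-! ### Gaussian bounds for binomial coefficients. -/

namespace TorusCRSF

lemma centralBinom_sq_le (N : ℕ) : (2 * (N : ℝ) + 1) * (N.centralBinom : ℝ) ^ 2 ≤ 16 ^ N := by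
  induction N with
  | zero => simp
  | succ N ih =>
    have h : ((N : ℝ) + 1) * ((N + 1).centralBinom : ℝ) = 2 * (2 * N + 1) * N.centralBinom := by
      exact_mod_cast Nat.succ_mul_centralBinom_succ N
    have hN : (0 : ℝ) < (N : ℝ) + 1 := by positivity
    have h2 : ((N + 1).centralBinom : ℝ) = 2 * (2 * N + 1) * N.centralBinom / ((N : ℝ) + 1) := by
      rw [eq_div_iff hN.ne', ← h]; ring
    rw [h2, pow_succ]
    push_cast
    calc (2 * ((N : ℝ) + 1) + 1) * (2 * (2 * N + 1) * N.centralBinom / ((N : ℝ) + 1)) ^ 2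
        = ((2 * (N : ℝ) + 1) * (N.centralBinom : ℝ) ^ 2) *
            (4 * (2 * N + 1) * (2 * N + 3) / ((N : ℝ) + 1) ^ 2) := by
          field_simp; ring
      _ ≤ 16 ^ N * 16 := by
          gcongr
          rw [div_le_iff₀ (by positivity)]
          nlinarith

lemma centralBinom_le (N : ℕ) : (N.centralBinom : ℝ) ≤ 4 ^ N / √(2 * (N : ℝ) + 1) := by
  have h := centralBinom_sq_le N
  have h0 : (0 : ℝ) < 2 * N + 1 := by positivity
  rw [le_div_iff₀ (Real.sqrt_pos.2 h0)]
  refine le_of_sq_le_sq ?_ (by positivity)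
  rw [mul_pow, Real.sq_sqrt h0.le, ← pow_mul, mul_comm N 2, pow_mul]
  norm_num
  linarith

/-- The ratio of consecutive coefficients is `1 - (2j+1)/(N+j+1) ≤ exp(-(2j+1)/(N+j+1))`, and the
odd numbers `2j+1` sum to a square. -/
lemma choose_two_mul_le {N : ℕ} (hN : 0 < N) (j : ℕ) :
    ((2 * N).choose (N + j) : ℝ) ≤
      N.centralBinom * Real.exp (-((j : ℝ) ^ 2 / ((N : ℝ) + j))) := by
  have hN' : (0 : ℝ) < N := by exact_mod_cast hN
  induction j with
  | zero => simp [Nat.centralBinom]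
  | succ j ih =>
    rcases le_or_gt N j with hj | hj
    · rw [Nat.choose_eq_zero_of_lt (by omega), Nat.cast_zero]
      positivity
    · have h := Nat.choose_succ_right_eq (2 * N) (N + j)
      have h' : ((2 * N).choose (N + (j + 1)) : ℝ) * ((N : ℝ) + j + 1) =
          (2 * N).choose (N + j) * ((N : ℝ) - j) := by
        rw [show 2 * N - (N + j) = N - j by omega] at h
        have := congrArg (Nat.cast (R := ℝ)) h
        push_cast [Nat.cast_sub hj.le] at this
        exact this
      have hpos : (0 : ℝ) < (N : ℝ) + j + 1 := by positivity
      have hjN : (j : ℝ) < N := by exact_mod_cast hj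
      have h1 : ((N : ℝ) - j) / ((N : ℝ) + j + 1) ≤
          Real.exp (-((2 * (j : ℝ) + 1) / ((N : ℝ) + j + 1))) := by
        have := Real.add_one_le_exp (-((2 * (j : ℝ) + 1) / ((N : ℝ) + j + 1)))
        refine le_trans (le_of_eq ?_) this
        field_simp; ring
      have h2 : ((2 * N).choose (N + (j + 1)) : ℝ) =
          (2 * N).choose (N + j) * (((N : ℝ) - j) / ((N : ℝ) + j + 1)) := by
        rw [← mul_div_assoc, eq_div_iff hpos.ne', h']
      rw [h2]
      calc _ ≤ (N.centralBinom * Real.exp (-((j : ℝ) ^ 2 / ((N : ℝ) + j)))) *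
            Real.exp (-((2 * (j : ℝ) + 1) / ((N : ℝ) + j + 1))) := by
            gcongr
        _ = N.centralBinom * Real.exp (-((j : ℝ) ^ 2 / ((N : ℝ) + j)) +
            -((2 * (j : ℝ) + 1) / ((N : ℝ) + j + 1))) := by rw [Real.exp_add]; ring
        _ ≤ _ := by
            refine mul_le_mul_of_nonneg_left (Real.exp_le_exp.2 ?_) (by positivity)
            have : (j : ℝ) ^ 2 / ((N : ℝ) + j + 1) ≤ (j : ℝ) ^ 2 / ((N : ℝ) + j) :=
              div_le_div_of_nonneg_left (by positivity) (by positivity) (by linarith)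
            push_cast
            have h3 : ((j : ℝ) + 1) ^ 2 / ((N : ℝ) + (j + 1)) =
                (j : ℝ) ^ 2 / ((N : ℝ) + j + 1) + (2 * (j : ℝ) + 1) / ((N : ℝ) + j + 1) := by
              rw [← add_div, ← add_assoc]; congr 1; ring
            rw [h3]; linarith

lemma choose_two_mul_gaussian {N : ℕ} (hN : 0 < N) (j : ℕ) :
    ((2 * N).choose (N + j) : ℝ) ≤
      4 ^ N / √(2 * (N : ℝ) + 1) * Real.exp (-((j : ℝ) ^ 2 / ((N : ℝ) + j))) :=
  (choose_two_mul_le hN j).trans (by gcongr; exact centralBinom_le N)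

lemma choose_add_gaussian_aux (l e : ℕ) (h : 0 < l + e) :
    ((l + e + l).choose (l + e) : ℝ) / 2 ^ (l + e + l) ≤
      2 / √(((l : ℝ) + e) + l + 1) *
        Real.exp (-((e : ℝ) ^ 2 / (2 * (((l : ℝ) + e) + l + 1 + e)))) := by
  rw [div_le_iff₀ (by positivity)]
  rcases Nat.even_or_odd' e with ⟨j, rfl | rfl⟩
  · have h1 := choose_two_mul_gaussian (N := l + j) (by omega) j
    rw [show 2 * (l + j) = l + 2 * j + l by ring, show l + j + j = l + 2 * j by ring] at h1
    refine h1.trans ?_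
    rw [show l + 2 * j + l = 2 * (l + j) by ring, pow_mul]
    push_cast
    rw [show (l : ℝ) + 2 * j + l + 1 = 2 * ((l : ℝ) + j) + 1 by ring]
    norm_num
    have h2 : Real.exp (-((j : ℝ) ^ 2 / ((l : ℝ) + j + j))) ≤
        Real.exp (-((2 * (j : ℝ)) ^ 2 / (2 * (2 * ((l : ℝ) + j) + 1 + 2 * j)))) := by
      have h0 : (0 : ℝ) < (l : ℝ) + j + j := by
        have : (0 : ℝ) < ((l + 2 * j : ℕ) : ℝ) := by exact_mod_cast h
        push_cast at this; linarith
      rw [Real.exp_le_exp, neg_le_neg_iff, div_le_div_iff₀ (by positivity) h0]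
      nlinarith [sq_nonneg (j : ℝ)]
    have h3 : (0 : ℝ) ≤ 4 ^ (l + j) / √(2 * ((l : ℝ) + j) + 1) := by positivity
    calc _ ≤ 4 ^ (l + j) / √(2 * ((l : ℝ) + j) + 1) *
          Real.exp (-((2 * (j : ℝ)) ^ 2 / (2 * (2 * ((l : ℝ) + j) + 1 + 2 * j)))) := by gcongr
      _ ≤ 2 * (4 ^ (l + j) / √(2 * ((l : ℝ) + j) + 1)) *
          Real.exp (-((2 * (j : ℝ)) ^ 2 / (2 * (2 * ((l : ℝ) + j) + 1 + 2 * j)))) := by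
          gcongr; linarith
      _ = _ := by ring
  -- An odd row embeds in the next even row by Pascal's rule, at the cost of the factor `2`; the `+
  -- 1` in the exponent's denominator leaves room for this shift.
  · have h1 := choose_two_mul_gaussian (N := l + j + 1) (by omega) (j + 1)
    have h2 : ((l + (2 * j + 1) + l).choose (l + (2 * j + 1)) : ℝ) ≤
        (2 * (l + j + 1)).choose (l + j + 1 + (j + 1)) := by
      rw [show 2 * (l + j + 1) = (l + (2 * j + 1) + l) + 1 by ring,
        show l + j + 1 + (j + 1) = (l + (2 * j + 1)) + 1 by ring, Nat.choose_succ_succ]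
      exact_mod_cast Nat.le_add_right _ _
    refine h2.trans (h1.trans ?_)
    have h3 : (4 : ℝ) ^ (l + j + 1) = 2 * 2 ^ (l + (2 * j + 1) + l) := by
      rw [← pow_succ', show l + (2 * j + 1) + l + 1 = 2 * (l + j + 1) by ring, pow_mul]; norm_num
    rw [h3]
    push_cast
    have h4 : Real.exp (-(((j : ℝ) + 1) ^ 2 / ((l : ℝ) + j + 1 + (j + 1)))) ≤
        Real.exp (-((2 * (j : ℝ) + 1) ^ 2 /
          (2 * ((l : ℝ) + (2 * j + 1) + l + 1 + (2 * j + 1))))) := by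
      rw [Real.exp_le_exp, neg_le_neg_iff, div_le_div_iff₀ (by positivity) (by positivity)]
      have hl : (0 : ℝ) ≤ l := by positivity
      have hj : (0 : ℝ) ≤ j := by positivity
      nlinarith [mul_nonneg hl hj, sq_nonneg (j : ℝ), mul_nonneg hj (sq_nonneg (j : ℝ)),
        mul_nonneg hl (sq_nonneg (j : ℝ))]
    calc _ ≤ 2 * 2 ^ (l + (2 * j + 1) + l) / √((l : ℝ) + (2 * j + 1) + l + 1) *
          Real.exp (-((2 * (j : ℝ) + 1) ^ 2 /
          (2 * ((l : ℝ) + (2 * j + 1) + l + 1 + (2 * j + 1))))) := by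
          gcongr
          linarith
      _ = _ := by ring

/-- A Gaussian upper bound for the binomial distribution with parameter `1/2`. -/
lemma choose_add_gaussian (k l : ℕ) (h : 0 < k + l) :
    ((k + l).choose k : ℝ) / 2 ^ (k + l) ≤
      2 / √((k : ℝ) + l + 1) *
        Real.exp (-(((k : ℝ) - l) ^ 2 / (2 * ((k : ℝ) + l + 1 + |(k : ℝ) - l|)))) := by
  rcases le_total l k with hle | hle
  · obtain ⟨e, rfl⟩ := Nat.exists_eq_add_of_le hle
    have := choose_add_gaussian_aux l e (by omega)
    push_cast
    rwa [show (l : ℝ) + e - l = e by ring, abs_of_nonneg (by positivity : (0 : ℝ) ≤ e)]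
  · obtain ⟨e, rfl⟩ := Nat.exists_eq_add_of_le hle
    have := choose_add_gaussian_aux k e (by omega)
    rw [Nat.choose_symm_add, add_comm k (k + e)]
    push_cast
    rw [show (k : ℝ) - (k + e) = -e by ring, abs_neg, neg_sq,
      abs_of_nonneg (by positivity : (0 : ℝ) ≤ e), add_comm (k : ℝ) (k + e)]
    exact this

/-! ### Resonant and non-resonant homology classes. -/

/-- The Gaussian factor of a closed walk in the homology class `(p, q)`. -/
noncomputable def resonantFactor (p q n m : ℕ) : ℝ :=
  Real.exp (-(((p : ℝ) * n - q * m) ^ 2 /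
    (2 * ((p : ℝ) * n + q * m + 1 + |(p : ℝ) * n - q * m|))))

/-- Imbalance and length both scale by `j`, so the Gaussian exponent is at least `j` times that of
the primitive class; the spare `+ 1` only helps as `j ≥ 1`. -/
lemma closed_walk_resonant_le {p q n m j : ℕ} (hp : 0 < p) (hn : 0 < n) (hj : 0 < j) :
    ((j * p * n + j * q * m).choose (j * p * n) : ℝ) / 2 ^ (j * p * n + j * q * m) ≤
      2 / √(n : ℝ) * resonantFactor p q n m ^ j := by
  have hpn : 0 < j * p * n := by positivity
  refine (choose_add_gaussian _ _ (by omega)).trans ?_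
  have hn' : (0 : ℝ) < n := by exact_mod_cast hn
  have hj1 : (1 : ℝ) ≤ j := by exact_mod_cast hj
  have hle : (n : ℝ) ≤ ((j * p * n : ℕ) : ℝ) := by
    exact_mod_cast Nat.le_mul_of_pos_left _ (Nat.mul_pos hj hp)
  rw [resonantFactor, ← Real.exp_nat_mul]
  have h0 : (0 : ℝ) ≤ ((j * q * m : ℕ) : ℝ) := by positivity
  have hsqrt : 2 / √(((j * p * n : ℕ) : ℝ) + ((j * q * m : ℕ) : ℝ) + 1) ≤ 2 / √(n : ℝ) := by
    gcongr
    linarith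
  refine mul_le_mul hsqrt (Real.exp_le_exp.2 ?_) (by positivity) (by positivity)
  push_cast
  set D := (p : ℝ) * n - q * m with hD
  set L := (p : ℝ) * n + q * m with hL
  have hL0 : 0 ≤ L := by positivity
  have h1 : (j : ℝ) * p * n - j * q * m = j * D := by rw [hD]; ring
  have h2 : (j : ℝ) * p * n + j * q * m = j * L := by rw [hL]; ring
  rw [h1, h2, mul_neg, neg_le_neg_iff, abs_mul, Nat.abs_cast, mul_div_assoc',
    div_le_div_iff₀ (by positivity) (by positivity)]
  have h3 : 0 ≤ D ^ 2 * j * (j - 1) := by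
    have : (0 : ℝ) ≤ j - 1 := by linarith
    positivity
  nlinarith

/-- With `d` the imbalance, `q d = (a q - b p) n + b D`. The integer `a q - b p` is nonzero and `|b
D| ≤ n / 2`, whence `|d| ≥ n / (2q)`. -/
lemma closed_walk_nonresonant_le {p q n m T a b : ℕ} (hq : 0 < q) (hn : 0 < n) (hm : 0 < m)
    (hne : a * q ≠ b * p) (hpos : 0 < a * n + b * m) (hT : a * n + b * m < T)
    (hsmall : 2 * (T * |(p : ℝ) * n - q * m|) ≤ (n : ℝ) * m) :
    ((a * n + b * m).choose (a * n) : ℝ) / 2 ^ (a * n + b * m) ≤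
      2 * Real.exp (-((n : ℝ) ^ 2 / (16 * (q : ℝ) ^ 2 * T))) := by
  refine (choose_add_gaussian _ _ hpos).trans ?_
  have hn' : (0 : ℝ) < n := by exact_mod_cast hn
  have hm' : (0 : ℝ) < m := by exact_mod_cast hm
  have hq' : (0 : ℝ) < q := by exact_mod_cast hq
  have hT0 : (0 : ℝ) < T := by exact_mod_cast (by omega : 0 < T)
  have hL : (a : ℝ) * n + b * m + 1 ≤ T := by exact_mod_cast hT
  push_cast
  set D := (p : ℝ) * n - q * m with hD
  set d := (a : ℝ) * n - b * m with hd
  have hqd : q * d = ((a : ℝ) * q - b * p) * n + b * D := by rw [hD, hd]; ring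
  have hint : (1 : ℝ) ≤ |(a : ℝ) * q - b * p| := by
    have h1 : (a : ℤ) * q - b * p ≠ 0 := sub_ne_zero.2 (by exact_mod_cast hne)
    have h2 := Int.one_le_abs h1
    exact_mod_cast h2
  have hbD : 2 * |b * D| ≤ n := by
    rw [abs_mul, Nat.abs_cast]
    have hbm : (b : ℝ) * m ≤ T := by nlinarith [mul_nonneg (Nat.cast_nonneg (α := ℝ) a) hn'.le]
    have h1 : (2 * (b * |D|)) * m ≤ n * m := by nlinarith [abs_nonneg D]
    exact le_of_mul_le_mul_right h1 hm'
  have hlow : (n : ℝ) ≤ 2 * q * |d| := by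
    have h1 : |((a : ℝ) * q - b * p) * n| ≤ |(q : ℝ) * d| + |b * D| := by
      have : ((a : ℝ) * q - b * p) * n = q * d - b * D := by rw [hqd]; ring
      rw [this]; exact abs_sub _ _
    rw [abs_mul, abs_mul, Nat.abs_cast, Nat.abs_cast] at h1
    nlinarith
  have hup : |d| ≤ a * n + b * m := by
    rw [hd, abs_le]
    constructor <;> nlinarith [mul_nonneg (Nat.cast_nonneg (α := ℝ) a) hn'.le,
      mul_nonneg (Nat.cast_nonneg (α := ℝ) b) hm'.le]
  have h1 : 2 / √((a : ℝ) * n + b * m + 1) ≤ 2 := by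
    apply div_le_self (by norm_num)
    rw [Real.one_le_sqrt]
    have : (0 : ℝ) ≤ a * n + b * m := by positivity
    linarith
  refine mul_le_mul h1 (Real.exp_le_exp.2 ?_) (by positivity) (by norm_num)
  rw [neg_le_neg_iff]
  have h2 : (n : ℝ) ^ 2 ≤ 4 * q ^ 2 * d ^ 2 := by
    calc (n : ℝ) ^ 2 ≤ (2 * q * |d|) ^ 2 := by gcongr
      _ = 4 * q ^ 2 * d ^ 2 := by rw [mul_pow, sq_abs]; ring
  calc (n : ℝ) ^ 2 / (16 * (q : ℝ) ^ 2 * T) ≤ 4 * q ^ 2 * d ^ 2 / (16 * (q : ℝ) ^ 2 * T) := by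
        gcongr
    _ = d ^ 2 / (2 * (T + T)) := by field_simp; norm_num; ring
    _ ≤ _ := by
        have : 0 ≤ |d| := abs_nonneg d
        gcongr
        linarith

lemma sum_shortClasses_le {p q n m T : ℕ} (hp : 0 < p) (hq : 0 < q) (hpq : Nat.Coprime p q)
    (hn : 0 < n) (hm : 0 < m) (hr : resonantFactor p q n m ≤ 1 / 2)
    (hsmall : 2 * (T * |(p : ℝ) * n - q * m|) ≤ (n : ℝ) * m) :
    ∑ x ∈ shortClasses n m T,
        ((x.1 * n + x.2 * m).choose (x.1 * n) : ℝ) / 2 ^ (x.1 * n + x.2 * m) ≤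
      4 / √(n : ℝ) * resonantFactor p q n m +
        (T : ℝ) ^ 2 * (2 * Real.exp (-((n : ℝ) ^ 2 / (16 * (q : ℝ) ^ 2 * T)))) := by
  classical
  set F : ℕ × ℕ → ℝ := fun x =>
    ((x.1 * n + x.2 * m).choose (x.1 * n) : ℝ) / 2 ^ (x.1 * n + x.2 * m) with hF
  have hF0 : ∀ x, 0 ≤ F x := fun x => by simp only [hF]; positivity
  set r := resonantFactor p q n m with hr_def
  have hr0 : 0 ≤ r := (Real.exp_pos _).le
  rw [← Finset.sum_filter_add_sum_filter_not _ (fun x : ℕ × ℕ => x.1 * q = x.2 * p)]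
  refine add_le_add ?_ ?_
  -- By coprimality the resonant classes are the positive multiples of `(p, q)`; their contributions
  -- are dominated by a geometric series of ratio at most `1/2`.
  · have hsub : (shortClasses n m T).filter (fun x : ℕ × ℕ => x.1 * q = x.2 * p) ⊆
        (Finset.range T).image fun i => ((i + 1) * p, (i + 1) * q) := by
      rintro ⟨a, b⟩ h
      simp only [shortClasses, Finset.mem_filter, Finset.mem_product, Finset.mem_range] at h
      obtain ⟨⟨⟨ha, hb⟩, hpos, _⟩, heq⟩ := h
      have hdvd : p ∣ a := hpq.dvd_of_dvd_mul_right (Dvd.intro_left b heq.symm)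
      obtain ⟨j, rfl⟩ := hdvd
      have hb' : b = j * q := by
        apply Nat.eq_of_mul_eq_mul_right hp
        rw [← heq]; ring
      have hj : 0 < j := by
        rcases Nat.eq_zero_or_pos j with rfl | hj
        · simp [hb'] at hpos
        · exact hj
      have hjT : j ≤ p * j := Nat.le_mul_of_pos_left _ hp
      rw [Finset.mem_image]
      refine ⟨j - 1, Finset.mem_range.2 (by omega), ?_⟩
      rw [Nat.sub_add_cancel hj, hb', mul_comm]
    calc _ ≤ ∑ x ∈ (Finset.range T).image fun i => ((i + 1) * p, (i + 1) * q), F x :=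
          Finset.sum_le_sum_of_subset_of_nonneg hsub fun x _ _ => hF0 x
      _ = ∑ i ∈ Finset.range T, F ((i + 1) * p, (i + 1) * q) := by
          refine Finset.sum_image fun i _ j _ h => ?_
          have := Nat.eq_of_mul_eq_mul_right hp (congrArg Prod.fst h)
          omega
      _ ≤ ∑ i ∈ Finset.range T, 2 / √(n : ℝ) * r * r ^ i := by
          refine Finset.sum_le_sum fun i _ => ?_
          have := closed_walk_resonant_le (q := q) (m := m) hp hn (Nat.succ_pos i)
          rw [mul_assoc, ← pow_succ']
          exact this
      _ = 2 / √(n : ℝ) * r * ∑ i ∈ Finset.range T, r ^ i := by rw [Finset.mul_sum]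
      _ ≤ 2 / √(n : ℝ) * r * 2 := by
          gcongr
          calc ∑ i ∈ Finset.range T, r ^ i ≤ ∑ i ∈ Finset.range T, (1 / 2 : ℝ) ^ i := by gcongr
            _ ≤ ∑' i : ℕ, (1 / 2 : ℝ) ^ i :=
              summable_geometric_two.sum_le_tsum _ fun i _ => by positivity
            _ = 2 := tsum_geometric_two
      _ = 4 / √(n : ℝ) * r := by ring
  · calc _ ≤ ∑ x ∈ (shortClasses n m T).filter (fun x : ℕ × ℕ => ¬ x.1 * q = x.2 * p),
          2 * Real.exp (-((n : ℝ) ^ 2 / (16 * (q : ℝ) ^ 2 * T))) := by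
          refine Finset.sum_le_sum fun x hx => ?_
          simp only [shortClasses, Finset.mem_filter] at hx
          exact closed_walk_nonresonant_le hq hn hm hx.2 hx.1.2.1 hx.1.2.2 hsmall
      _ ≤ _ := by
          rw [Finset.sum_const, nsmul_eq_mul]
          have h1 : ((shortClasses n m T).filter (fun x : ℕ × ℕ => ¬ x.1 * q = x.2 * p)).card ≤
              T ^ 2 := by
            refine (Finset.card_filter_le _ _).trans ((Finset.card_filter_le _ _).trans ?_)
            rw [Finset.card_product, Finset.card_range, sq]
          have h2 : (((shortClasses n m T).filter
              (fun x : ℕ × ℕ => ¬ x.1 * q = x.2 * p)).card : ℝ) ≤ (T : ℝ) ^ 2 := by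
            exact_mod_cast h1
          exact mul_le_mul_of_nonneg_right h2 (by positivity)

/-- An explicit bound for the probability of two disjoint cycles. -/
lemma crsfMeasure_twoDisjointCycles_le {p q n m T : ℕ} (hp : 0 < p) (hq : 0 < q)
    (hpq : Nat.Coprime p q) (hn : 0 < n) (hm : 0 < m) (hT : 0 < T)
    (hr : resonantFactor p q n m ≤ 1 / 2)
    (hsmall : 2 * (T * |(p : ℝ) * n - q * m|) ≤ (n : ℝ) * m) :
    (crsfMeasure n m).real (twoDisjointCycles n m) ≤
      ((n : ℝ) + m) * (4 / √(n : ℝ) * resonantFactor p q n m +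
        (T : ℝ) ^ 2 * (2 * Real.exp (-((n : ℝ) ^ 2 / (16 * (q : ℝ) ^ 2 * T))))) +
      ((n : ℝ) * m) ^ 2 * (2 * Real.exp (-((T : ℝ) ^ 3 / (96 * ((n : ℝ) * m) ^ 2)))) := by
  have : NeZero n := ⟨hn.ne'⟩
  have : NeZero m := ⟨hm.ne'⟩
  have hsub : twoDisjointCycles n m ⊆
      shortCycle n m T ∪ (twoDisjointCycles n m \ shortCycle n m T) := by
    rw [Set.union_sdiff_self]; exact Set.subset_union_right
  refine (measureReal_mono hsub (measure_ne_top _ _)).trans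
    ((measureReal_union_le _ _).trans (add_le_add ?_ (crsfMeasure_long_le hT)))
  exact (crsfMeasure_shortCycle_le T).trans
    (mul_le_mul_of_nonneg_left (sum_shortClasses_le hp hq hpq hn hm hr hsmall) (by positivity))

/-! ### Asymptotics along the sequence `m n`. -/

lemma tendsto_sqrt_mul_log_div_rpow {a : ℝ} (ha : 1 / 2 < a) :
    Tendsto (fun n : ℕ => √((n : ℝ) * Real.log n) / (n : ℝ) ^ a) atTop (𝓝 0) := by
  have h1 : Tendsto (fun n : ℕ => Real.log n / (n : ℝ) ^ (2 * a - 1)) atTop (𝓝 0) :=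
    ((isLittleO_log_rpow_atTop (by linarith : 0 < 2 * a - 1)).tendsto_div_nhds_zero).comp
      tendsto_natCast_atTop_atTop
  have h2 := (Real.continuous_sqrt.tendsto 0).comp h1
  rw [Real.sqrt_zero] at h2
  refine h2.congr' ?_
  filter_upwards [eventually_gt_atTop 0] with n hn
  have hn' : (0 : ℝ) < n := by exact_mod_cast hn
  have h3 : (n : ℝ) ^ a = √((n : ℝ) ^ (2 * a)) := by
    rw [mul_comm, Real.rpow_mul hn'.le, Real.rpow_two, Real.sqrt_sq (by positivity)]
  have hlog : 0 ≤ Real.log n := Real.log_natCast_nonneg n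
  rw [Function.comp_apply, h3, ← Real.sqrt_div (by positivity), Real.rpow_sub hn', Real.rpow_one]
  congr 1
  field_simp

lemma eventually_mul_rpow_le {a b : ℝ} (hab : a < b) (K : ℝ) :
    ∀ᶠ n : ℕ in atTop, K * (n : ℝ) ^ a ≤ (n : ℝ) ^ b := by
  have h1 : Tendsto (fun n : ℕ => (n : ℝ) ^ (b - a)) atTop atTop :=
    (tendsto_rpow_atTop (by linarith : 0 < b - a)).comp tendsto_natCast_atTop_atTop
  filter_upwards [h1.eventually_ge_atTop K, eventually_gt_atTop 0] with n hn h0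
  have hn' : (0 : ℝ) < n := by exact_mod_cast h0
  calc K * (n : ℝ) ^ a ≤ (n : ℝ) ^ (b - a) * (n : ℝ) ^ a := by gcongr
    _ = (n : ℝ) ^ b := by rw [← Real.rpow_add hn']; congr 1; ring

lemma eventually_mul_rpow_mul_exp_le {c s : ℝ} (hc : 0 < c) (hs : 0 < s) (a b K : ℝ) (hK : 0 ≤ K) :
    ∀ᶠ n : ℕ in atTop, K * (n : ℝ) ^ a * Real.exp (-(c * (n : ℝ) ^ s)) ≤ (n : ℝ) ^ b := by
  have h1 : Tendsto (fun n : ℕ => ((n : ℝ) ^ s) ^ ((a - b + 1) / s) *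
      Real.exp (-c * (n : ℝ) ^ s)) atTop (𝓝 0) :=
    (tendsto_rpow_mul_exp_neg_mul_atTop_nhds_zero ((a - b + 1) / s) c hc).comp
      ((tendsto_rpow_atTop hs).comp tendsto_natCast_atTop_atTop)
  filter_upwards [h1.eventually_le_const (by norm_num : (0 : ℝ) < 1), eventually_gt_atTop 0,
    eventually_mul_rpow_le (by linarith : b - 1 < b) K] with n hn h0 hK
  have hn' : (0 : ℝ) < n := by exact_mod_cast h0
  rw [← Real.rpow_mul hn'.le, mul_div_cancel₀ _ hs.ne', neg_mul] at hn
  have h2 : (n : ℝ) ^ a = (n : ℝ) ^ (b - 1) * (n : ℝ) ^ (a - b + 1) := by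
    rw [← Real.rpow_add hn']; congr 1; ring
  calc _ = K * (n : ℝ) ^ (b - 1) *
        ((n : ℝ) ^ (a - b + 1) * Real.exp (-(c * (n : ℝ) ^ s))) := by rw [h2]; ring
    _ ≤ K * (n : ℝ) ^ (b - 1) * 1 := by gcongr
    _ ≤ _ := by rwa [mul_one]

section Regime

variable {p q : ℕ} {C : ℝ} {m : ℕ → ℕ} {o : ℕ → ℝ}

lemma eventually_offset_eq (hq : 0 < q)
    (hm : ∀ᶠ n : ℕ in atTop,
      (m n : ℝ) = (p : ℝ) / (q : ℝ) * (n : ℝ) + C * √((n : ℝ) * Real.log (n : ℝ)) * (1 + o n)) :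
    ∀ᶠ n : ℕ in atTop, (p : ℝ) * n - q * m n =
      -(q * C * (1 + o n)) * √((n : ℝ) * Real.log (n : ℝ)) := by
  filter_upwards [hm] with n hn
  have : (q : ℝ) ≠ 0 := by exact_mod_cast hq.ne'
  rw [hn]
  field_simp
  ring

lemma tendsto_offset_div_rpow (hq : 0 < q) (ho : Tendsto o atTop (𝓝 0))
    (hm : ∀ᶠ n : ℕ in atTop,
      (m n : ℝ) = (p : ℝ) / (q : ℝ) * (n : ℝ) + C * √((n : ℝ) * Real.log (n : ℝ)) * (1 + o n))
    {a : ℝ} (ha : 1 / 2 < a) :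
    Tendsto (fun n : ℕ => |(p : ℝ) * n - q * m n| / (n : ℝ) ^ a) atTop (𝓝 0) := by
  have h1 : Tendsto (fun n : ℕ => -(q * C * (1 + o n))) atTop (𝓝 (-(q * C * (1 + 0)))) :=
    ((ho.const_add 1).const_mul _).neg
  have h2 := (h1.mul (tendsto_sqrt_mul_log_div_rpow ha)).abs
  rw [mul_zero, abs_zero] at h2
  refine h2.congr' ?_
  filter_upwards [eventually_offset_eq hq hm] with n hn
  rw [hn, ← mul_div_assoc, abs_div, abs_of_nonneg (by positivity : (0 : ℝ) ≤ (n : ℝ) ^ a)]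

lemma tendsto_height_div (hq : 0 < q) (ho : Tendsto o atTop (𝓝 0))
    (hm : ∀ᶠ n : ℕ in atTop,
      (m n : ℝ) = (p : ℝ) / (q : ℝ) * (n : ℝ) + C * √((n : ℝ) * Real.log (n : ℝ)) * (1 + o n)) :
    Tendsto (fun n : ℕ => (m n : ℝ) / n) atTop (𝓝 ((p : ℝ) / q)) := by
  have h0 := tendsto_sqrt_mul_log_div_rpow (by norm_num : (1 / 2 : ℝ) < 1)
  have h1 : Tendsto (fun n : ℕ => (p : ℝ) / q + C * (1 + o n) *
      (√((n : ℝ) * Real.log n) / (n : ℝ) ^ (1 : ℝ))) atTop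
      (𝓝 ((p : ℝ) / q + C * (1 + 0) * 0)) :=
    (((ho.const_add 1).const_mul C).mul h0).const_add _
  rw [mul_zero, add_zero] at h1
  refine h1.congr' ?_
  filter_upwards [hm, eventually_gt_atTop 0] with n hn hn0
  have hn' : (0 : ℝ) < n := by exact_mod_cast hn0
  rw [hn, Real.rpow_one]
  field_simp

/-- The squared offset is `q² C² (1 + o(1)) n log n` and the denominator is `4 p n (1 + o(1))`, so
any exponent below the quotient of the constants is eventually attained. -/
lemma eventually_resonantFactor_le (hp : 0 < p) (hq : 0 < q) (ho : Tendsto o atTop (𝓝 0))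
    (hm : ∀ᶠ n : ℕ in atTop,
      (m n : ℝ) = (p : ℝ) / (q : ℝ) * (n : ℝ) + C * √((n : ℝ) * Real.log (n : ℝ)) * (1 + o n))
    {s : ℝ} (hs : s < q ^ 2 * C ^ 2 / (4 * p)) :
    ∀ᶠ n : ℕ in atTop, resonantFactor p q n (m n) ≤ (n : ℝ) ^ (-s) := by
  have hp' : (0 : ℝ) < p := by exact_mod_cast hp
  have hq' : (0 : ℝ) < q := by exact_mod_cast hq
  have hD := tendsto_offset_div_rpow hq ho hm (by norm_num : (1 / 2 : ℝ) < 1)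
  have hden : Tendsto (fun n : ℕ => 2 * ((p : ℝ) + q * ((m n : ℝ) / n) + 1 / (n : ℝ) +
      |(p : ℝ) * n - q * m n| / (n : ℝ) ^ (1 : ℝ))) atTop
      (𝓝 (2 * ((p : ℝ) + q * ((p : ℝ) / q) + 0 + 0))) :=
    (((((tendsto_height_div hq ho hm).const_mul _).const_add _).add
      tendsto_one_div_atTop_nhds_zero_nat).add hD).const_mul _
  have hnum : Tendsto (fun n : ℕ => (q : ℝ) ^ 2 * C ^ 2 * (1 + o n) ^ 2) atTop
      (𝓝 ((q : ℝ) ^ 2 * C ^ 2 * (1 + 0) ^ 2)) := ((ho.const_add 1).pow 2).const_mul _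
  have hlim : 2 * ((p : ℝ) + q * ((p : ℝ) / q) + 0 + 0) = 4 * p := by field_simp; ring
  rw [hlim] at hden
  have h := hnum.div hden (by positivity)
  rw [add_zero, one_pow, mul_one] at h
  filter_upwards [h.eventually_const_lt hs, eventually_offset_eq hq hm, eventually_gt_atTop 0]
    with n hn hoff hn0
  have hn' : (0 : ℝ) < n := by exact_mod_cast hn0
  have hlog : 0 ≤ Real.log n := Real.log_natCast_nonneg n
  rw [resonantFactor, Real.rpow_def_of_pos hn', Real.exp_le_exp, mul_neg, neg_le_neg_iff]
  have hsq : ((p : ℝ) * n - q * m n) ^ 2 =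
      q ^ 2 * C ^ 2 * (1 + o n) ^ 2 * (n * Real.log n) := by
    rw [hoff, mul_pow, Real.sq_sqrt (by positivity)]; ring
  have heq : ((p : ℝ) * n - q * m n) ^ 2 /
      (2 * ((p : ℝ) * n + q * m n + 1 + |(p : ℝ) * n - q * m n|)) =
      (q ^ 2 * C ^ 2 * (1 + o n) ^ 2) / (2 * ((p : ℝ) + q * ((m n : ℝ) / n) + 1 / (n : ℝ) +
      |(p : ℝ) * n - q * m n| / (n : ℝ) ^ (1 : ℝ))) * Real.log n := by
    rw [hsq, Real.rpow_one]
    generalize |(p : ℝ) * n - q * m n| = D at *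
    have : 2 * ((p : ℝ) + q * ((m n : ℝ) / n) + 1 / (n : ℝ) + D / n) =
        2 * ((p : ℝ) * n + q * m n + 1 + D) / n := by field_simp
    rw [this, div_div_eq_mul_div]
    ring
  rw [heq, mul_comm]
  exact mul_le_mul_of_nonneg_right hn.le hlog

end Regime

end TorusCRSF

/-! ### Choice of scale and conclusion. -/

open TorusCRSF in
theorem mainTheorem11 (p q : ℕ) (hp : 0 < p) (hq : 0 < q) (hpq : Nat.Coprime p q)
    (C : ℝ) (hC : √(2 * (p : ℝ)) < |C|)
    (m : ℕ → ℕ) (o : ℕ → ℝ) (ho : Tendsto o atTop (𝓝 0))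
    (hm : ∀ᶠ n : ℕ in atTop,
      (m n : ℝ) = (p : ℝ) / (q : ℝ) * (n : ℝ) + C * √((n : ℝ) * Real.log (n : ℝ)) * (1 + o n))
    (ε : ℝ) (hε : 0 < ε) :
    ∀ᶠ n : ℕ in atTop,
      (TorusCRSF.crsfMeasure n (m n)).real (TorusCRSF.twoDisjointCycles n (m n)) ≤
        (n : ℝ) ^ ((1 : ℝ) / 2 - C ^ 2 / (4 * (p : ℝ)) + ε) := by
  have hp' : (0 : ℝ) < p := by exact_mod_cast hp
  have hq' : (0 : ℝ) < q := by exact_mod_cast hq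
  have hq1 : (1 : ℝ) ≤ q := by exact_mod_cast hq
  have hC0 : 0 < C ^ 2 := by
    have : 0 < |C| := lt_of_le_of_lt (Real.sqrt_nonneg _) hC
    rw [← sq_abs]; positivity
  -- Half of `ε` absorbs the `o(1)` in the exponent; the other half absorbs multiplicative
  -- constants.
  set s : ℝ := C ^ 2 / (4 * p) - ε / 2 with hs_def
  have hs : s < q ^ 2 * C ^ 2 / (4 * p) := by
    have h1 : C ^ 2 / (4 * (p : ℝ)) ≤ q ^ 2 * C ^ 2 / (4 * p) := by
      gcongr
      exact le_mul_of_one_le_left hC0.le (one_le_pow₀ hq1)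
    linarith
  set θ : ℝ := (1 : ℝ) / 2 - C ^ 2 / (4 * (p : ℝ)) + ε with hθ
  set κ : ℝ := (p : ℝ) / q with hκ
  have hκ0 : 0 < κ := by positivity
  have hheight := tendsto_height_div hq ho hm
  have hhalf : ∀ᶠ n : ℕ in atTop, resonantFactor p q n (m n) ≤ 1 / 2 := by
    have h1 : 0 < q ^ 2 * C ^ 2 / (4 * (p : ℝ)) := by positivity
    filter_upwards [eventually_resonantFactor_le hp hq ho hm (half_lt_self h1),
      eventually_mul_rpow_le (by linarith : -(q ^ 2 * C ^ 2 / (4 * (p : ℝ)) / 2) < 0) 2]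
      with n h2 h3
    rw [Real.rpow_zero] at h3
    linarith
  have hfac := eventually_resonantFactor_le hp hq ho hm hs
  have hoff := tendsto_offset_div_rpow hq ho hm (by norm_num : (1 / 2 : ℝ) < 3 / 5)
  -- The factor `3` here and below makes each of the three error terms at most a third of `n ^ θ`.
  have hterm₁ := eventually_mul_rpow_le (by rw [hs_def, hθ]; linarith : 1 / 2 - s < θ)
    (3 * (4 * (1 + (κ + 1))))
  have hterm₂ := eventually_mul_rpow_mul_exp_le (by positivity : 0 < 1 / (16 * (q : ℝ) ^ 2))
    (by norm_num : (0 : ℝ) < 3 / 5) (19 / 5) θ (3 * (2 * (1 + (κ + 1)))) (by positivity)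
  have hterm₃ := eventually_mul_rpow_mul_exp_le (by positivity : 0 < 1 / (768 * (κ + 1) ^ 2))
    (by norm_num : (0 : ℝ) < 1 / 5) 4 θ (3 * (2 * (κ + 1) ^ 2)) (by positivity)
  filter_upwards [hheight.eventually_lt_const (by linarith : κ < κ + 1),
    hheight.eventually_const_lt (half_lt_self hκ0), hhalf, hfac,
    hoff.eventually_lt_const (by positivity : 0 < κ / 4), hterm₁, hterm₂, hterm₃,
    eventually_ge_atTop 2] with n hup hlow hhalf hfac hoff hterm₁ hterm₂ hterm₃ hn2
  have hn : 0 < n := by omega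
  have hn2' : (2 : ℝ) ≤ n := by exact_mod_cast hn2
  have hn' : (0 : ℝ) < n := by linarith
  rw [div_lt_iff₀ hn'] at hup
  rw [lt_div_iff₀ hn'] at hlow
  have hm' : (0 : ℝ) < m n := lt_of_le_of_lt (by positivity) hlow
  have hm0 : 0 < m n := by exact_mod_cast hm'
  -- The exponent must exceed `4/3`, for `T³ / n⁴` to grow as a power of `n`, and stay below `3/2`,
  -- for `T |D|` to be small against `n²`.
  set T : ℕ := ⌊(n : ℝ) ^ (7 / 5 : ℝ)⌋₊ with hT_def
  have hpow : (2 : ℝ) ≤ (n : ℝ) ^ (7 / 5 : ℝ) :=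
    hn2'.trans (Real.self_le_rpow_of_one_le (by linarith) (by norm_num))
  have hTle : (T : ℝ) ≤ (n : ℝ) ^ (7 / 5 : ℝ) := Nat.floor_le (by positivity)
  have hTge : (n : ℝ) ^ (7 / 5 : ℝ) / 2 ≤ T := by
    have := Nat.lt_floor_add_one ((n : ℝ) ^ (7 / 5 : ℝ))
    rw [← hT_def] at this
    linarith
  have hT' : (0 : ℝ) < T := lt_of_lt_of_le (by positivity) hTge
  have hT0 : 0 < T := by exact_mod_cast hT'
  rw [div_lt_iff₀ (by positivity)] at hoff
  have hsmall : 2 * (T * |(p : ℝ) * n - q * m n|) ≤ (n : ℝ) * m n := by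
    calc 2 * (T * |(p : ℝ) * n - q * m n|)
        ≤ 2 * ((n : ℝ) ^ (7 / 5 : ℝ) * (κ / 4 * (n : ℝ) ^ (3 / 5 : ℝ))) := by gcongr
      _ = κ / 2 * ((n : ℝ) ^ (7 / 5 : ℝ) * (n : ℝ) ^ (3 / 5 : ℝ)) := by ring
      _ = n * (κ / 2 * n) := by
          rw [← Real.rpow_add hn', show (7 / 5 : ℝ) + 3 / 5 = 2 by norm_num, Real.rpow_two]; ring
      _ ≤ n * m n := by gcongr
  refine (crsfMeasure_twoDisjointCycles_le hp hq hpq hn hm0 hT0 hhalf hsmall).trans ?_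
  have hnm : (n : ℝ) + m n ≤ (1 + (κ + 1)) * n := by linarith
  have hr0 : 0 ≤ resonantFactor p q n (m n) := (Real.exp_pos _).le
  have h₁ : ((n : ℝ) + m n) * (4 / √(n : ℝ) * resonantFactor p q n (m n)) ≤
      4 * (1 + (κ + 1)) * (n : ℝ) ^ (1 / 2 - s) := by
    calc _ ≤ (1 + (κ + 1)) * n * (4 / √(n : ℝ) * (n : ℝ) ^ (-s)) := by gcongr
      _ = 4 * (1 + (κ + 1)) * (n / √(n : ℝ) * (n : ℝ) ^ (-s)) := by ring
      _ = _ := by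
          rw [Real.div_sqrt, Real.sqrt_eq_rpow, ← Real.rpow_add hn', ← sub_eq_add_neg]
  have h₂ : ((n : ℝ) + m n) *
      ((T : ℝ) ^ 2 * (2 * Real.exp (-((n : ℝ) ^ 2 / (16 * (q : ℝ) ^ 2 * T))))) ≤
      2 * (1 + (κ + 1)) * (n : ℝ) ^ (19 / 5 : ℝ) *
        Real.exp (-(1 / (16 * (q : ℝ) ^ 2) * (n : ℝ) ^ (3 / 5 : ℝ))) := by
    have h1 : 1 / (16 * (q : ℝ) ^ 2) * (n : ℝ) ^ (3 / 5 : ℝ) ≤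
        (n : ℝ) ^ 2 / (16 * (q : ℝ) ^ 2 * T) := by
      calc 1 / (16 * (q : ℝ) ^ 2) * (n : ℝ) ^ (3 / 5 : ℝ)
          = (n : ℝ) ^ 2 / (16 * (q : ℝ) ^ 2 * (n : ℝ) ^ (7 / 5 : ℝ)) := by
            have h2 : (n : ℝ) ^ (3 / 5 : ℝ) * (n : ℝ) ^ (7 / 5 : ℝ) = (n : ℝ) ^ 2 := by
              rw [← Real.rpow_add hn', show (3 / 5 : ℝ) + 7 / 5 = 2 by norm_num, Real.rpow_two]
            rw [← h2]
            field_simp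
        _ ≤ _ := by gcongr
    calc _ ≤ (1 + (κ + 1)) * n * (((n : ℝ) ^ (7 / 5 : ℝ)) ^ 2 *
          (2 * Real.exp (-(1 / (16 * (q : ℝ) ^ 2) * (n : ℝ) ^ (3 / 5 : ℝ))))) := by gcongr
      _ = 2 * (1 + (κ + 1)) * (n * ((n : ℝ) ^ (7 / 5 : ℝ)) ^ 2) *
          Real.exp (-(1 / (16 * (q : ℝ) ^ 2) * (n : ℝ) ^ (3 / 5 : ℝ))) := by ring
      _ = _ := by
          congr 2
          rw [← Real.rpow_natCast, ← Real.rpow_mul hn'.le, mul_comm, ← Real.rpow_add_one hn'.ne']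
          norm_num
  have h₃ : ((n : ℝ) * m n) ^ 2 *
      (2 * Real.exp (-((T : ℝ) ^ 3 / (96 * ((n : ℝ) * m n) ^ 2)))) ≤
      2 * (κ + 1) ^ 2 * (n : ℝ) ^ (4 : ℝ) *
        Real.exp (-(1 / (768 * (κ + 1) ^ 2) * (n : ℝ) ^ (1 / 5 : ℝ))) := by
    have h4 : (n : ℝ) ^ (4 : ℝ) = (n : ℝ) ^ 4 := by
      rw [← Real.rpow_natCast]; norm_num
    have hA : ((n : ℝ) * m n) ^ 2 ≤ (κ + 1) ^ 2 * (n : ℝ) ^ 4 := by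
      calc ((n : ℝ) * m n) ^ 2 ≤ (n * ((κ + 1) * n)) ^ 2 := by gcongr
        _ = _ := by ring
    have h1 : 1 / (768 * (κ + 1) ^ 2) * (n : ℝ) ^ (1 / 5 : ℝ) ≤
        (T : ℝ) ^ 3 / (96 * ((n : ℝ) * m n) ^ 2) := by
      calc 1 / (768 * (κ + 1) ^ 2) * (n : ℝ) ^ (1 / 5 : ℝ)
          = ((n : ℝ) ^ (7 / 5 : ℝ) / 2) ^ 3 / (96 * ((κ + 1) ^ 2 * (n : ℝ) ^ 4)) := by
            have h2 : ((n : ℝ) ^ (7 / 5 : ℝ)) ^ 3 = (n : ℝ) ^ (1 / 5 : ℝ) * (n : ℝ) ^ 4 := by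
              rw [← h4, ← Real.rpow_add hn', ← Real.rpow_natCast, ← Real.rpow_mul hn'.le]
              norm_num
            rw [div_pow, h2]
            field_simp
            norm_num
        _ ≤ _ := by gcongr
    rw [h4]
    calc _ ≤ (κ + 1) ^ 2 * (n : ℝ) ^ 4 *
          (2 * Real.exp (-(1 / (768 * (κ + 1) ^ 2) * (n : ℝ) ^ (1 / 5 : ℝ)))) := by gcongr
      _ = _ := by ring
  rw [mul_add]
  linarith
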